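/- There are universal constants $C,K,c\in(0,\infty)$ with the following property. Let $p\in[2,\infty)$, let $(S,\mu)$ be a measure space and let $L_p(\mu)$ be the corresponding space of real-valued functions. Let $N\ge 1$ and let $\mathbf W=\{W_t\}_{t=1}^\infty$ be a stationary Markov chain with state space $[N]=\{1,\dots,N\}$, i.e. a Markov chain with a stochastic transition matrix $A=(a_{ij})\in M_N(\mathbb R)$ such that the law $\pi=(\Pr[W_1=1],\dots,\Pr[W_1=N])$ of $W_1$ satisfies $\pi A=\pi$. Let $$\lambda_{\mathbf W}=\sup\Bigg\{\bigg(\sum_{i=1}^N\pi_i\Big(\sum_{j=1}^N a_{ij}u_j-\sum_{k=1}^N\pi_ku_k\Big)^2\bigg)^{1/2}:\ u\in\mathbb R^N,\ \sum_{k=1}^N\pi_ku_k^2=1\Bigg\}$$ and assume that $\lambda_{\mathbf W}<1$. Then for every $f:[N]\to L_p(\mu)$ and every integer $n\ge1$ the following hold. (1) For every $q\in[p,\infty)$, $$\Bigg(\mathbb E\bigg[\Big\|\frac{f(W_1)+\cdots+f(W_n)}{n}-\mathbb E[f(W_1)]\Big\|_{L_p(\mu)}^q\bigg]\Bigg)^{1/q}\le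 C\sqrt{\frac{q}{(1-\lambda_{\mathbf W})n}}\,\Big(\mathbb E\big[\|f(W_1)\|_{L_p(\mu)}^q\big]\Big)^{1/q}.$$ (2) If $f$ is not identically $0$, then for every $a>0$, $$\Pr\bigg[\Big\|\frac{f(W_1)+\cdots+f(W_n)}{n}-\mathbb E[f(W_1)]\Big\|_{L_p(\mu)}\ge a\max_{j\in[N]}\|f(j)\|_{L_p(\mu)}\bigg]\le K\,e^{\,p-c(1-\lambda_{\mathbf W})na^2}.$$ -/

import Mathlib

open MeasureTheory ProbabilityTheory
open scoped Matrix

namespace MarkovConcentration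

/-- `W 0, W 1, …` is a (time-homogeneous) Markov chain on the probability space `(Ω, P)` with state
space `Fin N` and transition matrix `A`. The Markov property
`P[W (t+1) = x (t+1) | W 0 = x 0, …, W t = x t] = A (x t) (x (t+1))` is written in product form, so
that histories of probability zero impose no condition. -/
structure IsMarkovChain {Ω : Type*} [MeasurableSpace Ω] (P : Measure Ω) {N : ℕ}
    (W : ℕ → Ω → Fin N) (A : Matrix (Fin N) (Fin N) ℝ) : Prop where
  measurable : ∀ t, Measurable (W t)
  stochastic : A ∈ Matrix.rowStochastic ℝ (Fin N)
  markov : ∀ (t : ℕ) (x : ℕ → Fin N),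
    P.real {ω | ∀ s ≤ t + 1, W s ω = x s} =
      P.real {ω | ∀ s ≤ t, W s ω = x s} * A (x t) (x (t + 1))

/-- The distribution of the first state of the chain, as a vector of probabilities. -/
noncomputable def initialLaw {Ω : Type*} [MeasurableSpace Ω] (P : Measure Ω) {N : ℕ}
    (W : ℕ → Ω → Fin N) : Fin N → ℝ :=
  fun i => P.real {ω | W 0 ω = i}

/-- The matrix `A` is `π`-stationary: `π A = π` (with `π` a row vector). -/
def IsStationaryLaw {N : ℕ} (π : Fin N → ℝ) (A : Matrix (Fin N) (Fin N) ℝ) : Prop :=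
  π ᵥ* A = π

/-- The norm of `A - E_π` as an operator on `L₂(π)`, where `E_π` is the matrix all of whose rows
equal `π`. -/
noncomputable def lambdaNorm {N : ℕ} (π : Fin N → ℝ) (A : Matrix (Fin N) (Fin N) ℝ) : ℝ :=
  sSup {r : ℝ | ∃ u : Fin N → ℝ, ∑ k, π k * u k ^ 2 = 1 ∧
    r = √(∑ i, π i * (∑ j, A i j * u j - ∑ k, π k * u k) ^ 2)}

/-- The supremum that defines `lambdaNorm` is over a bounded set when `π` is a probability vector
and `A` is a `π`-stationary stochastic matrix. -/
theorem bddAbove_lambdaNorm {N : ℕ} (π : Fin N → ℝ) (A : Matrix (Fin N) (Fin N) ℝ)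
    (hπ : π ∈ stdSimplex ℝ (Fin N)) (hA : A ∈ Matrix.rowStochastic ℝ (Fin N))
    (hs : IsStationaryLaw π A) :
    BddAbove {r : ℝ | ∃ u : Fin N → ℝ, ∑ k, π k * u k ^ 2 = 1 ∧
      r = √(∑ i, π i * (∑ j, A i j * u j - ∑ k, π k * u k) ^ 2)} := by
  refine ⟨2, ?_⟩
  rintro r ⟨u, hu, rfl⟩
  have hA0 : ∀ i j, 0 ≤ A i j := fun i j => hA.1 i j
  have hA1 : ∀ i, ∑ j, A i j = 1 := fun i => by
    have h := congrFun hA.2 i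
    simpa [Matrix.mulVec, dotProduct] using h
  have hst : ∀ j, ∑ i, π i * A i j = π j := fun j => congrFun hs j
  have jensen : ∀ v : Fin N → ℝ, (∀ j, 0 ≤ v j) → ∑ j, v j = 1 →
      (∑ j, v j * u j) ^ 2 ≤ ∑ j, v j * u j ^ 2 := by
    intro v hv hv1
    have h := Finset.sum_sq_le_sum_mul_sum_of_sq_le_mul Finset.univ
      (r := fun j => v j * u j) (f := v) (g := fun j => v j * u j ^ 2)
      (fun j _ => hv j) (fun j _ => mul_nonneg (hv j) (sq_nonneg _)) (fun j _ => le_of_eq (by ring))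
    simpa [hv1] using h
  have hm := jensen π hπ.1 hπ.2
  rw [hu] at hm
  have h1 : ∑ i, π i * (∑ j, A i j * u j - ∑ k, π k * u k) ^ 2
      ≤ ∑ i, (2 * ∑ j, π i * A i j * u j ^ 2 + 2 * π i) := by
    refine Finset.sum_le_sum fun i _ => ?_
    have h2 := jensen (A i) (hA0 i) (hA1 i)
    have h3 : ∑ j, π i * A i j * u j ^ 2 = π i * ∑ j, A i j * u j ^ 2 := by
      rw [Finset.mul_sum]
      exact Finset.sum_congr rfl fun j _ => by ring
    rw [h3]
    have h4 : (∑ j, A i j * u j - ∑ k, π k * u k) ^ 2 ≤ 2 * ∑ j, A i j * u j ^ 2 + 2 := by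
      nlinarith [sq_nonneg (∑ j, A i j * u j + ∑ k, π k * u k)]
    nlinarith [mul_le_mul_of_nonneg_left h4 (hπ.1 i)]
  have h5 : ∑ i, (2 * ∑ j, π i * A i j * u j ^ 2 + 2 * π i) = 4 := by
    rw [Finset.sum_add_distrib, ← Finset.mul_sum, ← Finset.mul_sum, hπ.2, Finset.sum_comm]
    have h6 : ∀ j, ∑ i, π i * A i j * u j ^ 2 = π j * u j ^ 2 := fun j => by
      rw [← Finset.sum_mul, hst]
    simp only [h6, hu]
    norm_num
  exact Real.sqrt_le_iff.2 ⟨by norm_num, by linarith⟩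

/-- The number `λ_W` of a chain `W` with transition matrix `A`: the norm `lambdaNorm` taken with
respect to the law of the first state. -/
noncomputable def chainLambda {Ω : Type*} [MeasurableSpace Ω] (P : Measure Ω) {N : ℕ}
    (W : ℕ → Ω → Fin N) (A : Matrix (Fin N) (Fin N) ℝ) : ℝ :=
  lambdaNorm (initialLaw P W) A

end MarkovConcentration

namespace MarkovConcentration

/-! ### Complex interpolation for finite mixed-norm spaces -/

/-! The tail bound follows from the moment bound. Markov's inequality is applied to the `q`-th power
of the deviation with `q` proportional to `(1 - λ) n a²`; when this `q` is below `p` the claimed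
bound exceeds 1. The moment bound is a norm estimate for a linear operator, the one that sends `f`
to its centred empirical mean as a function of the path. It is proved for real functions and even
`q` by a moment recursion, then extended by interpolation.

Moment recursion. Let `f` be centred with norm at most 1 in `L_q(π)`, and let `u L k i` be the
expectation of `S_L ^ k / k!` from state `i`. Conditioning on one step and iterating gives `u L k =
∑_d A^d r`, where `r` contains only moments of order below `k` (`condMoment_eq_sum`). Split `u L k`
into its `π`-mean and its fluctuation. The operator `A^d - E_π` has norm at most 2 on `L_1` and
`L_∞` and at most `l^d` on `L_2`, so by Riesz–Thorin it decays geometrically on `L_{q/k}` for `0 < k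
< q` (`PowBall.fluct`). Summing over `d` costs a factor of order `1 / ((1 - l) s (1 - s))` with `s =
k / q`; the product of `1 / (s (1 - s))` over `k < q` is only exponential in `q` (`growth_le`). In
the mean, the term of `r` linear in `f` sees only the fluctuation of the lower moment, because `f`
is centred (`abs_mean_condMomentRest_le`). This cancellation gives growth `√n` in place of `n`. The
induction is `momentBound`; at order `k = q` only the mean is needed, so no decay on `L_1` is
required.

Extension. Interpolation between even integers reaches every real `q ≥ 2`
(`IsMarkovChain.scalarBound`). A scalar kernel bound on `L_q` extends with the same constant to
`L_q(L_q)` by Fubini and to `L_q(ℓ_2)` by averaging over directions; interpolating the inner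
exponent gives `L_q(L_p)` for `2 ≤ p ≤ q` (`ScalarBound.kernelBound`), and density of simple
functions gives general `μ` (`ScalarBound.lp`).

Unit balls are described throughout by witnesses: `|f| ≤ u ^ s` with `u` of mass at most 1.
Interpolation then only moves the exponent `s`, and `s = 0` covers `L_∞`. -/

/-- Entire functions that are bounded on the strip `0 ≤ re z ≤ 1`. -/
def BddOnStrip (F : ℂ → ℂ) : Prop :=
  Differentiable ℂ F ∧ ∃ C : ℝ, ∀ z : ℂ, 0 ≤ z.re → z.re ≤ 1 → ‖F z‖ ≤ C

theorem BddOnStrip.const (c : ℂ) : BddOnStrip fun _ => c :=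
  ⟨differentiable_const c, ‖c‖, fun _ _ _ => le_rfl⟩

theorem BddOnStrip.mul {F G : ℂ → ℂ} (hF : BddOnStrip F) (hG : BddOnStrip G) :
    BddOnStrip fun z => F z * G z := by
  obtain ⟨hF, C, hC⟩ := hF
  obtain ⟨hG, D, hD⟩ := hG
  refine ⟨hF.mul hG, C * D, fun z h0 h1 => ?_⟩
  rw [norm_mul]
  exact mul_le_mul (hC z h0 h1) (hD z h0 h1) (norm_nonneg _) ((norm_nonneg _).trans (hC z h0 h1))

theorem BddOnStrip.sum {ι : Type*} (s : Finset ι) {F : ι → ℂ → ℂ}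
    (hF : ∀ i ∈ s, BddOnStrip (F i)) : BddOnStrip fun z => ∑ i ∈ s, F i z := by
  classical
  induction s using Finset.induction_on with
  | empty => simpa using BddOnStrip.const 0
  | insert a s ha ih =>
    obtain ⟨h1, C, hC⟩ := hF a (Finset.mem_insert_self a s)
    obtain ⟨h2, D, hD⟩ := ih fun i hi => hF i (Finset.mem_insert_of_mem hi)
    simp only [Finset.sum_insert ha]
    exact ⟨h1.add h2, C + D, fun z h0 h1 => (norm_add_le _ _).trans (add_le_add (hC z h0 h1) (hD z h0 h1))⟩

/-- For `u > 0` the family is `u` raised to an exponent affine in `z`. For `u = 0` the convention `0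
^ 0 = 1` forces a case split: the constant 1 if both exponents vanish, and otherwise 0, since the
intermediate exponent is then nonzero. -/
theorem exists_rpow_family {u s₀ s₁ θ : ℝ} (hu : 0 ≤ u) (h₀ : 0 ≤ s₀) (h₁ : 0 ≤ s₁)
    (hθ₀ : 0 < θ) (hθ₁ : θ < 1) :
    ∃ U : ℂ → ℂ, BddOnStrip U ∧ (∀ z : ℂ, z.re = 0 → ‖U z‖ ≤ u ^ s₀) ∧
      (∀ z : ℂ, z.re = 1 → ‖U z‖ ≤ u ^ s₁) ∧
      U θ = ((u ^ ((1 - θ) * s₀ + θ * s₁) : ℝ) : ℂ) := by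
  rcases hu.eq_or_lt with rfl | hu
  · by_cases hs : s₀ = 0 ∧ s₁ = 0
    · obtain ⟨rfl, rfl⟩ := hs
      exact ⟨fun _ => 1, BddOnStrip.const 1, by simp, by simp, by simp⟩
    · refine ⟨fun _ => 0, BddOnStrip.const 0, fun z _ => ?_, fun z _ => ?_, ?_⟩
      · simpa using Real.rpow_nonneg le_rfl _
      · simpa using Real.rpow_nonneg le_rfl _
      · rw [Real.zero_rpow]
        · simp
        · intro h
          apply hs
          have ha : 0 ≤ (1 - θ) * s₀ := mul_nonneg (by linarith) h₀
          have hb : 0 ≤ θ * s₁ := mul_nonneg hθ₀.le h₁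
          have ha' : (1 - θ) * s₀ = 0 := by linarith
          have hb' : θ * s₁ = 0 := by linarith
          exact ⟨(mul_eq_zero.1 ha').resolve_left (by linarith),
            (mul_eq_zero.1 hb').resolve_left (by linarith)⟩
  · have hnorm : ∀ z : ℂ, ‖Complex.exp ((Real.log u : ℂ) * ((1 - z) * s₀ + z * s₁))‖
        = Real.exp (Real.log u * ((1 - z.re) * s₀ + z.re * s₁)) := fun z => by
      rw [Complex.norm_exp]
      congr 1
      simp
    refine ⟨fun z => Complex.exp ((Real.log u : ℂ) * ((1 - z) * s₀ + z * s₁)),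
      ⟨by fun_prop, Real.exp (|Real.log u| * (s₀ + s₁)), fun z hz0 hz1 => ?_⟩,
      fun z hz => ?_, fun z hz => ?_, ?_⟩
    · rw [hnorm, Real.exp_le_exp]
      have hn : 0 ≤ (1 - z.re) * s₀ + z.re * s₁ :=
        add_nonneg (mul_nonneg (by linarith) h₀) (mul_nonneg hz0 h₁)
      exact mul_le_mul (le_abs_self _) (by nlinarith) hn (abs_nonneg _)
    · rw [hnorm, hz, Real.rpow_def_of_pos hu]
      simp
    · rw [hnorm, hz, Real.rpow_def_of_pos hu]
      simp
    · rw [Real.rpow_def_of_pos hu]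
      push_cast
      rfl

/-- The three lines theorem for `BddOnStrip` functions. -/
theorem BddOnStrip.norm_le_interp {F : ℂ → ℂ} (hF : BddOnStrip F) {M₀ M₁ θ : ℝ}
    (hθ₀ : 0 ≤ θ) (hθ₁ : θ ≤ 1) (h₀ : ∀ z : ℂ, z.re = 0 → ‖F z‖ ≤ M₀)
    (h₁ : ∀ z : ℂ, z.re = 1 → ‖F z‖ ≤ M₁) : ‖F θ‖ ≤ M₀ ^ (1 - θ) * M₁ ^ θ := by
  have h := Complex.HadamardThreeLines.norm_le_interp_of_mem_verticalClosedStrip₀₁' F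
    (z := (θ : ℂ)) (a := M₀) (b := M₁) ?_ hF.1.diffContOnCl ?_ (fun z hz => h₀ z hz)
    (fun z hz => h₁ z hz)
  · simpa using h
  · simpa [Complex.HadamardThreeLines.verticalClosedStrip] using ⟨hθ₀, hθ₁⟩
  · obtain ⟨C, hC⟩ := hF.2
    refine ⟨C, ?_⟩
    rintro _ ⟨z, hz, rfl⟩
    exact hC z hz.1 hz.2

/-- A uniform description of the unit ball of `L_{1/s}(a; L_{1/r}(b))` that makes sense also when
`s = 0` or `r = 0`. -/
def MixedBall {X Y : Type*} [Fintype X] [Fintype Y] (a : X → ℝ) (b : Y → ℝ) (s r : ℝ)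
    (f : X → Y → ℂ) : Prop :=
  ∃ (u : X → ℝ) (v : X → Y → ℝ), (∀ x, 0 ≤ u x) ∧ (∀ x y, 0 ≤ v x y) ∧ ∑ x, a x * u x ≤ 1 ∧
    (∀ x, ∑ y, b y * v x y ≤ 1) ∧ ∀ x y, ‖f x y‖ ≤ u x ^ s * v x y ^ r

/-- Only the exponents move with `z`; the witnesses `u` and `v` serve on both edges. The quotient of
`f` by its majorant at `θ` is independent of `z` and has modulus at most 1, and `f` vanishes
wherever that majorant does. -/
theorem MixedBall.exists_family {X Y : Type*} [Fintype X] [Fintype Y] {a : X → ℝ} {b : Y → ℝ}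
    {s₀ s₁ r₀ r₁ θ : ℝ} (hs₀ : 0 ≤ s₀) (hs₁ : 0 ≤ s₁) (hr₀ : 0 ≤ r₀) (hr₁ : 0 ≤ r₁)
    (hθ₀ : 0 < θ) (hθ₁ : θ < 1) {f : X → Y → ℂ}
    (hf : MixedBall a b ((1 - θ) * s₀ + θ * s₁) ((1 - θ) * r₀ + θ * r₁) f) :
    ∃ F : ℂ → X → Y → ℂ, (∀ x y, BddOnStrip fun z => F z x y) ∧
      (∀ z : ℂ, z.re = 0 → MixedBall a b s₀ r₀ (F z)) ∧
      (∀ z : ℂ, z.re = 1 → MixedBall a b s₁ r₁ (F z)) ∧ F θ = f := by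
  obtain ⟨u, v, hu, hv, hau, hbv, hle⟩ := hf
  choose U hU hU₀ hU₁ hUθ using fun x => exists_rpow_family (hu x) hs₀ hs₁ hθ₀ hθ₁
  choose V hV hV₀ hV₁ hVθ using fun x y => exists_rpow_family (hv x y) hr₀ hr₁ hθ₀ hθ₁
  set φ : X → Y → ℂ := fun x y => f x y / (U x θ * V x y θ) with hφ
  have hUV : ∀ x y, ‖U x θ * V x y θ‖ = u x ^ ((1 - θ) * s₀ + θ * s₁) *
      v x y ^ ((1 - θ) * r₀ + θ * r₁) := fun x y => by
    rw [hUθ, hVθ, ← Complex.ofReal_mul, Complex.norm_real, Real.norm_of_nonneg]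
    exact mul_nonneg (Real.rpow_nonneg (hu x) _) (Real.rpow_nonneg (hv x y) _)
  have hφ1 : ∀ x y, ‖φ x y‖ ≤ 1 := fun x y => by
    rw [hφ]
    simp only [norm_div]
    exact div_le_one_of_le₀ ((hle x y).trans_eq (hUV x y).symm) (norm_nonneg _)
  have key : ∀ (z : ℂ) (x : X) (y : Y) (A B : ℝ), ‖U x z‖ ≤ A → ‖V x y z‖ ≤ B →
      ‖φ x y * (U x z * V x y z)‖ ≤ A * B := fun z x y A B h1 h2 => by
    rw [norm_mul, norm_mul]
    calc ‖φ x y‖ * (‖U x z‖ * ‖V x y z‖) ≤ 1 * (‖U x z‖ * ‖V x y z‖) :=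
          mul_le_mul_of_nonneg_right (hφ1 x y) (by positivity)
      _ ≤ A * B := by
          rw [one_mul]
          exact mul_le_mul h1 h2 (norm_nonneg _) ((norm_nonneg _).trans h1)
  refine ⟨fun z x y => φ x y * (U x z * V x y z),
    fun x y => (BddOnStrip.const _).mul ((hU x).mul (hV x y)),
    fun z hz => ⟨u, v, hu, hv, hau, hbv, fun x y => key z x y _ _ (hU₀ x z hz) (hV₀ x y z hz)⟩,
    fun z hz => ⟨u, v, hu, hv, hau, hbv, fun x y => key z x y _ _ (hU₁ x z hz) (hV₁ x y z hz)⟩, ?_⟩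
  funext x y
  by_cases h0 : U x θ * V x y θ = 0
  · have h1 := hle x y
    rw [← hUV, h0, norm_zero] at h1
    simp [h0, norm_le_zero_iff.1 h1]
  · exact div_mul_cancel₀ _ h0

/-- The Riesz–Thorin theorem for bilinear forms on finite mixed-norm spaces. -/
theorem MixedBall.riesz_thorin {X Y Z T : Type*} [Fintype X] [Fintype Y] [Fintype Z] [Fintype T]
    {a : X → ℝ} {b : Y → ℝ} {w : Z → ℝ} {b' : T → ℝ} (c : X → Y → Z → T → ℂ)
    {s₀ s₁ r₀ r₁ σ₀ σ₁ ρ₀ ρ₁ θ M₀ M₁ : ℝ}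
    (hs₀ : 0 ≤ s₀) (hs₁ : 0 ≤ s₁) (hr₀ : 0 ≤ r₀) (hr₁ : 0 ≤ r₁)
    (hσ₀ : 0 ≤ σ₀) (hσ₁ : 0 ≤ σ₁) (hρ₀ : 0 ≤ ρ₀) (hρ₁ : 0 ≤ ρ₁)
    (hθ₀ : 0 ≤ θ) (hθ₁ : θ ≤ 1)
    (h₀ : ∀ f g, MixedBall a b s₀ r₀ f → MixedBall w b' σ₀ ρ₀ g →
      ‖∑ x, ∑ y, ∑ z, ∑ t, c x y z t * (f x y * g z t)‖ ≤ M₀)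
    (h₁ : ∀ f g, MixedBall a b s₁ r₁ f → MixedBall w b' σ₁ ρ₁ g →
      ‖∑ x, ∑ y, ∑ z, ∑ t, c x y z t * (f x y * g z t)‖ ≤ M₁)
    {f : X → Y → ℂ} {g : Z → T → ℂ}
    (hf : MixedBall a b ((1 - θ) * s₀ + θ * s₁) ((1 - θ) * r₀ + θ * r₁) f)
    (hg : MixedBall w b' ((1 - θ) * σ₀ + θ * σ₁) ((1 - θ) * ρ₀ + θ * ρ₁) g) :
    ‖∑ x, ∑ y, ∑ z, ∑ t, c x y z t * (f x y * g z t)‖ ≤ M₀ ^ (1 - θ) * M₁ ^ θ := by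
  rcases hθ₀.eq_or_lt with rfl | hθ₀
  · simp only [sub_zero, one_mul, zero_mul, add_zero] at hf hg
    simpa using h₀ f g hf hg
  rcases hθ₁.eq_or_lt with rfl | hθ₁
  · simp only [sub_self, one_mul, zero_mul, zero_add] at hf hg
    simpa using h₁ f g hf hg
  obtain ⟨F, hF, hF₀, hF₁, hFθ⟩ := hf.exists_family hs₀ hs₁ hr₀ hr₁ hθ₀ hθ₁
  obtain ⟨G, hG, hG₀, hG₁, hGθ⟩ := hg.exists_family hσ₀ hσ₁ hρ₀ hρ₁ hθ₀ hθ₁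
  have hB : BddOnStrip fun ζ => ∑ x, ∑ y, ∑ z, ∑ t, c x y z t * (F ζ x y * G ζ z t) :=
    BddOnStrip.sum _ fun x _ => BddOnStrip.sum _ fun y _ => BddOnStrip.sum _ fun z _ =>
      BddOnStrip.sum _ fun t _ => (BddOnStrip.const _).mul ((hF x y).mul (hG z t))
  have h := hB.norm_le_interp hθ₀.le hθ₁.le (fun ζ hζ => h₀ _ _ (hF₀ ζ hζ) (hG₀ ζ hζ))
    (fun ζ hζ => h₁ _ _ (hF₁ ζ hζ) (hG₁ ζ hζ))
  simpa only [hFθ, hGθ] using h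

end MarkovConcentration

namespace MarkovConcentration

/-! ### The unit balls of `L_{1/s}(a)` -/

/-- `f` has norm at most `c` in `L_{1/s}(a)`; this makes sense also when `s = 0`. -/
def PowBall {X : Type*} [Fintype X] (a : X → ℝ) (s c : ℝ) (f : X → ℝ) : Prop :=
  ∃ u : X → ℝ, (∀ x, 0 ≤ u x) ∧ ∑ x, a x * u x ≤ 1 ∧ ∀ x, |f x| ≤ c * u x ^ s

variable {X : Type*} [Fintype X] {a : X → ℝ}

theorem PowBall.mono {s c c' : ℝ} {f : X → ℝ} (hf : PowBall a s c f) (h : c ≤ c') :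
    PowBall a s c' f := by
  obtain ⟨u, hu, hau, hle⟩ := hf
  exact ⟨u, hu, hau, fun x => (hle x).trans
    (mul_le_mul_of_nonneg_right h (Real.rpow_nonneg (hu x) s))⟩

theorem PowBall.const (ha : ∑ x, a x ≤ 1) (s : ℝ) {c k : ℝ} (h : |k| ≤ c) :
    PowBall a s c fun _ => k :=
  ⟨fun _ => 1, fun _ => zero_le_one, by simpa using ha, fun _ => by simpa using h⟩

theorem PowBall.const_mul {s c : ℝ} {f : X → ℝ} (hf : PowBall a s c f) (k : ℝ) :
    PowBall a s (|k| * c) fun x => k * f x := by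
  obtain ⟨u, hu, hau, hle⟩ := hf
  refine ⟨u, hu, hau, fun x => ?_⟩
  rw [abs_mul, mul_assoc]
  exact mul_le_mul_of_nonneg_left (hle x) (abs_nonneg k)

/-- Hölder's inequality. The witnesses are averaged with weights proportional to the exponents, and
the weighted arithmetic–geometric mean inequality gives the pointwise bound. -/
theorem PowBall.mul {s s' c c' : ℝ} {f g : X → ℝ} (hf : PowBall a s c f) (hg : PowBall a s' c' g)
    (hs : 0 ≤ s) (hs' : 0 ≤ s') (hss : 0 < s + s') (hc : 0 ≤ c) (hc' : 0 ≤ c') :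
    PowBall a (s + s') (c * c') fun x => f x * g x := by
  obtain ⟨u, hu, hau, hle⟩ := hf
  obtain ⟨u', hu', hau', hle'⟩ := hg
  refine ⟨fun x => s / (s + s') * u x + s' / (s + s') * u' x, fun x => ?_, ?_, fun x => ?_⟩
  · have := hu x
    have := hu' x
    positivity
  · calc ∑ x, a x * (s / (s + s') * u x + s' / (s + s') * u' x)
        = s / (s + s') * ∑ x, a x * u x + s' / (s + s') * ∑ x, a x * u' x := by
          rw [Finset.mul_sum, Finset.mul_sum, ← Finset.sum_add_distrib]
          exact Finset.sum_congr rfl fun x _ => by ring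
      _ ≤ s / (s + s') * 1 + s' / (s + s') * 1 := by gcongr
      _ = 1 := by field_simp
  · have h1 := Real.geom_mean_le_arith_mean2_weighted (w₁ := s / (s + s')) (w₂ := s' / (s + s'))
      (by positivity) (by positivity) (hu x) (hu' x) (by field_simp)
    have h2 : u x ^ s * u' x ^ s' =
        (u x ^ (s / (s + s')) * u' x ^ (s' / (s + s'))) ^ (s + s') := by
      rw [Real.mul_rpow (Real.rpow_nonneg (hu x) _) (Real.rpow_nonneg (hu' x) _),
        ← Real.rpow_mul (hu x), ← Real.rpow_mul (hu' x), div_mul_cancel₀ _ hss.ne',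
        div_mul_cancel₀ _ hss.ne']
    calc |f x * g x| = |f x| * |g x| := abs_mul _ _
      _ ≤ (c * u x ^ s) * (c' * u' x ^ s') :=
          mul_le_mul (hle x) (hle' x) (abs_nonneg _) (mul_nonneg hc (Real.rpow_nonneg (hu x) s))
      _ = c * c' * (u x ^ s * u' x ^ s') := by ring
      _ ≤ _ := by
          rw [h2]
          exact mul_le_mul_of_nonneg_left (Real.rpow_le_rpow (mul_nonneg
            (Real.rpow_nonneg (hu x) _) (Real.rpow_nonneg (hu' x) _)) h1 hss.le) (by positivity)

/-- Minkowski's inequality. The witnesses are averaged with weights proportional to `c` and `c'`,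
and concavity of `t ^ s` for `s ≤ 1` gives the pointwise bound. If `c + c' = 0` there are no such
weights. -/
theorem PowBall.add {s c c' : ℝ} {f g : X → ℝ} (hf : PowBall a s c f) (hg : PowBall a s c' g)
    (hs : 0 ≤ s) (hs1 : s ≤ 1) (hc : 0 ≤ c) (hc' : 0 ≤ c') :
    PowBall a s (c + c') fun x => f x + g x := by
  rcases (add_nonneg hc hc').eq_or_lt with h0 | h0
  · obtain ⟨u, hu, hau, hle⟩ := hf
    obtain ⟨u', hu', hau', hle'⟩ := hg
    have h1 : c = 0 := by linarith
    have h2 : c' = 0 := by linarith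
    subst h1 h2
    refine ⟨u, hu, hau, fun x => ?_⟩
    have h3 := hle x
    have h4 := hle' x
    rw [zero_mul] at h3 h4
    rw [zero_add, zero_mul]
    exact (abs_add_le _ _).trans (by linarith)
  obtain ⟨u, hu, hau, hle⟩ := hf
  obtain ⟨u', hu', hau', hle'⟩ := hg
  refine ⟨fun x => c / (c + c') * u x + c' / (c + c') * u' x, fun x => ?_, ?_, fun x => ?_⟩
  · have := hu x
    have := hu' x
    positivity
  · calc ∑ x, a x * (c / (c + c') * u x + c' / (c + c') * u' x)
        = c / (c + c') * ∑ x, a x * u x + c' / (c + c') * ∑ x, a x * u' x := by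
          rw [Finset.mul_sum, Finset.mul_sum, ← Finset.sum_add_distrib]
          exact Finset.sum_congr rfl fun x _ => by ring
      _ ≤ c / (c + c') * 1 + c' / (c + c') * 1 := by gcongr
      _ = 1 := by field_simp
  · have h1 := (Real.concaveOn_rpow hs hs1).2 (hu x) (hu' x)
      (show 0 ≤ c / (c + c') by positivity) (show 0 ≤ c' / (c + c') by positivity) (by field_simp)
    simp only [smul_eq_mul] at h1
    calc |f x + g x| ≤ c * u x ^ s + c' * u' x ^ s :=
          (abs_add_le _ _).trans (add_le_add (hle x) (hle' x))
      _ = (c + c') * (c / (c + c') * u x ^ s + c' / (c + c') * u' x ^ s) := by field_simp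
      _ ≤ _ := mul_le_mul_of_nonneg_left h1 h0.le

theorem PowBall.sum {ι : Type*} (t : Finset ι) {s : ℝ} {c : ι → ℝ} {f : ι → X → ℝ}
    (hf : ∀ i ∈ t, PowBall a s (c i) (f i)) (hs : 0 ≤ s) (hs1 : s ≤ 1) (hc : ∀ i ∈ t, 0 ≤ c i) :
    PowBall a s (∑ i ∈ t, c i) fun x => ∑ i ∈ t, f i x := by
  classical
  induction t using Finset.induction_on with
  | empty => exact ⟨fun _ => 0, fun _ => le_rfl, by simp, fun x => by simp⟩
  | insert i t hi ih =>
    simp only [Finset.sum_insert hi]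
    exact (hf i (Finset.mem_insert_self i t)).add
      (ih (fun j hj => hf j (Finset.mem_insert_of_mem hj))
        fun j hj => hc j (Finset.mem_insert_of_mem hj)) hs hs1
      (hc i (Finset.mem_insert_self i t))
      (Finset.sum_nonneg fun j hj => hc j (Finset.mem_insert_of_mem hj))

theorem PowBall.pow {s : ℝ} {f : X → ℝ} (hf : PowBall a s 1 f) (j : ℕ) :
    PowBall a (j * s) 1 fun x => f x ^ j := by
  obtain ⟨u, hu, hau, hle⟩ := hf
  refine ⟨u, hu, hau, fun x => ?_⟩
  have h := hle x
  rw [one_mul] at h ⊢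
  rw [abs_pow, mul_comm, Real.rpow_mul_natCast (hu x)]
  exact pow_le_pow_left₀ (abs_nonneg _) h j

theorem sum_mul_rpow_le {v u : X → ℝ} {s : ℝ} (hv : ∀ x, 0 ≤ v x) (hv1 : ∑ x, v x = 1)
    (hu : ∀ x, 0 ≤ u x) (hs : 0 ≤ s) (hs1 : s ≤ 1) :
    ∑ x, v x * u x ^ s ≤ (∑ x, v x * u x) ^ s := by
  have h := (Real.concaveOn_rpow hs hs1).le_map_sum (t := Finset.univ) (w := v) (p := u)
    (fun x _ => hv x) hv1 fun x _ => hu x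
  simpa using h

theorem PowBall.abs_mean_le {s c : ℝ} {f : X → ℝ} (hf : PowBall a s c f) (ha : ∀ x, 0 ≤ a x)
    (ha1 : ∑ x, a x = 1) (hs : 0 ≤ s) (hs1 : s ≤ 1) (hc : 0 ≤ c) : |∑ x, a x * f x| ≤ c := by
  obtain ⟨u, hu, hau, hle⟩ := hf
  calc |∑ x, a x * f x| ≤ ∑ x, |a x * f x| := Finset.abs_sum_le_sum_abs _ _
    _ ≤ ∑ x, c * (a x * u x ^ s) := Finset.sum_le_sum fun x _ => by
        rw [abs_mul, abs_of_nonneg (ha x), mul_left_comm]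
        exact mul_le_mul_of_nonneg_left (hle x) (ha x)
    _ = c * ∑ x, a x * u x ^ s := by rw [Finset.mul_sum]
    _ ≤ c * 1 := by
        gcongr
        exact (sum_mul_rpow_le ha ha1 hu hs hs1).trans
          (Real.rpow_le_one (Finset.sum_nonneg fun x _ => mul_nonneg (ha x) (hu x)) hau hs)
    _ = c := mul_one c

/-- Duality between `L_{1/s}` and `L_{1/(1-s)}`. -/
theorem PowBall.of_dual {s M : ℝ} {f : X → ℝ} (ha : ∀ x, 0 ≤ a x) (hs : 0 < s) (hM : 0 < M)
    (h : ∀ g, PowBall a (1 - s) 1 g → ∑ x, a x * (f x * g x) ≤ M) : PowBall a s M f := by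
  set R := ∑ x, a x * |f x| ^ (1 / s) with hR
  have hR0 : 0 ≤ R := Finset.sum_nonneg fun x _ => mul_nonneg (ha x) (by positivity)
  have hRM : R ^ s ≤ M := by
    rcases hR0.eq_or_lt with h0 | h0
    · rw [← h0, Real.zero_rpow hs.ne']
      exact hM.le
    -- The extremal function in Hölder's inequality; its pairing with `f` is exactly `R ^ s`.
    have h1 := h (fun x => SignType.sign (f x) * (|f x| ^ (1 / s) / R) ^ (1 - s))
      ⟨fun x => |f x| ^ (1 / s) / R, fun x => by positivity, ?_, fun x => ?_⟩
    · refine le_trans (le_of_eq ?_) h1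
      have h2 : ∀ x, a x * (f x * (SignType.sign (f x) * (|f x| ^ (1 / s) / R) ^ (1 - s)))
          = (a x * |f x| ^ (1 / s)) * R ^ (s - 1) := fun x => by
        by_cases hfx : f x = 0
        · have : 1 / s ≠ 0 := by positivity
          simp [hfx, Real.zero_rpow (inv_ne_zero hs.ne')]
        have hfx' : 0 < |f x| := abs_pos.2 hfx
        rw [Real.div_rpow (by positivity) h0.le, ← Real.rpow_mul hfx'.le,
          ← mul_assoc (f x), self_mul_sign, div_eq_mul_inv, ← Real.rpow_neg h0.le, neg_sub,
          ← mul_assoc |f x|, ← Real.rpow_one_add' hfx'.le]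
        · have : 1 + 1 / s * (1 - s) = 1 / s := by field_simp; ring
          rw [this]
          ring
        · have : 1 + 1 / s * (1 - s) = 1 / s := by field_simp; ring
          rw [this]
          positivity
      simp only [h2]
      rw [← Finset.sum_mul, ← hR]
      nth_rewrite 2 [← Real.rpow_one R]
      rw [← Real.rpow_add h0]
      congr 1
      ring
    · rw [show ∑ x, a x * (|f x| ^ (1 / s) / R) = R / R by
        rw [hR, Finset.sum_div]
        exact Finset.sum_congr rfl fun x _ => by rw [mul_div_assoc]]
      exact div_self_le_one R
    · rw [abs_mul, one_mul, abs_of_nonneg (Real.rpow_nonneg (by positivity) (1 - s))]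
      refine mul_le_of_le_one_left (by positivity) ?_
      rcases lt_trichotomy (f x) 0 with hx | hx | hx <;> simp [hx]
  refine ⟨fun x => (|f x| / M) ^ (1 / s), fun x => by positivity, ?_, fun x => ?_⟩
  · calc ∑ x, a x * (|f x| / M) ^ (1 / s) = R / M ^ (1 / s) := by
          rw [hR, Finset.sum_div]
          exact Finset.sum_congr rfl fun x _ => by
            rw [Real.div_rpow (abs_nonneg _) hM.le, mul_div_assoc]
      _ ≤ 1 := by
          refine div_le_one_of_le₀ ?_ (by positivity)
          calc R = (R ^ s) ^ (1 / s) := by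
                rw [← Real.rpow_mul hR0, mul_one_div_cancel hs.ne', Real.rpow_one]
            _ ≤ M ^ (1 / s) := Real.rpow_le_rpow (by positivity) hRM (by positivity)
  · rw [← Real.rpow_mul (by positivity), one_div_mul_cancel hs.ne', Real.rpow_one]
    exact le_of_eq (by field_simp)

end MarkovConcentration

namespace MarkovConcentration

/-! ### Stochastic matrices with a spectral gap -/

/-- `A` is a stochastic matrix, `π` is a stationary law and `A` contracts the mean-zero part of
`L₂(π)` by the factor `l`. -/
structure HasGap {X : Type*} [Fintype X] (π : X → ℝ) (A : Matrix X X ℝ) (l : ℝ) : Prop where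
  law_nonneg : ∀ i, 0 ≤ π i
  law_sum : ∑ i, π i = 1
  nonneg : ∀ i j, 0 ≤ A i j
  row_sum : ∀ i, ∑ j, A i j = 1
  stationary : ∀ j, ∑ i, π i * A i j = π j
  pos : 0 < l
  lt_one : l < 1
  gap : ∀ v : X → ℝ, ∑ i, π i * v i = 0 →
    ∑ i, π i * (A *ᵥ v) i ^ 2 ≤ l ^ 2 * ∑ i, π i * v i ^ 2

variable {X : Type*} [Fintype X] {π : X → ℝ} {A : Matrix X X ℝ} {l : ℝ}

theorem sum_mul_mulVec (hs : ∀ j, ∑ i, π i * A i j = π j) (v : X → ℝ) :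
    ∑ i, π i * (A *ᵥ v) i = ∑ i, π i * v i := by
  simp only [Matrix.mulVec, dotProduct, Finset.mul_sum]
  rw [Finset.sum_comm]
  refine Finset.sum_congr rfl fun j _ => ?_
  rw [← hs j, Finset.sum_mul]
  exact Finset.sum_congr rfl fun i _ => by rw [mul_assoc]

theorem mulVec_const (hr : ∀ i, ∑ j, A i j = 1) (k : ℝ) : (A *ᵥ fun _ => k) = fun _ => k := by
  funext i
  simp only [Matrix.mulVec, dotProduct]
  rw [← Finset.sum_mul, hr, one_mul]

/-- Jensen's inequality in each row makes `A *ᵥ u` a witness, and stationarity preserves its mass.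
-/
theorem PowBall.mulVec (h : HasGap π A l) {s c : ℝ} {f : X → ℝ} (hf : PowBall π s c f)
    (hs : 0 ≤ s) (hs1 : s ≤ 1) (hc : 0 ≤ c) : PowBall π s c (A *ᵥ f) := by
  obtain ⟨u, hu, hau, hle⟩ := hf
  refine ⟨A *ᵥ u, fun i => Finset.sum_nonneg fun j _ => mul_nonneg (h.nonneg i j) (hu j),
    (sum_mul_mulVec h.stationary u).trans_le hau, fun i => ?_⟩
  calc |(A *ᵥ f) i| ≤ ∑ j, |A i j * f j| := Finset.abs_sum_le_sum_abs _ _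
    _ ≤ ∑ j, c * (A i j * u j ^ s) := Finset.sum_le_sum fun j _ => by
        rw [abs_mul, abs_of_nonneg (h.nonneg i j), mul_left_comm]
        exact mul_le_mul_of_nonneg_left (hle j) (h.nonneg i j)
    _ = c * ∑ j, A i j * u j ^ s := by rw [Finset.mul_sum]
    _ ≤ c * (∑ j, A i j * u j) ^ s := mul_le_mul_of_nonneg_left
        (sum_mul_rpow_le (h.nonneg i) (h.row_sum i) hu hs hs1) hc

variable [DecidableEq X]

namespace HasGap

theorem pow_nonneg (h : HasGap π A l) (d : ℕ) : ∀ i j, 0 ≤ (A ^ d) i j := by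
  induction d with
  | zero => intro i j; rw [pow_zero, Matrix.one_apply]; split_ifs <;> norm_num
  | succ d ih =>
    intro i j
    rw [pow_succ, Matrix.mul_apply]
    exact Finset.sum_nonneg fun k _ => mul_nonneg (ih i k) (h.nonneg k j)

theorem pow_row_sum (h : HasGap π A l) (d : ℕ) : ∀ i, ∑ j, (A ^ d) i j = 1 := by
  induction d with
  | zero => intro i; simp [Matrix.one_apply]
  | succ d ih =>
    intro i
    simp only [pow_succ, Matrix.mul_apply]
    rw [Finset.sum_comm]
    simp only [← Finset.mul_sum, h.row_sum, mul_one, ih]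

theorem pow_stationary (h : HasGap π A l) (d : ℕ) : ∀ j, ∑ i, π i * (A ^ d) i j = π j := by
  induction d with
  | zero => intro j; simp [Matrix.one_apply]
  | succ d ih =>
    intro j
    simp only [pow_succ, Matrix.mul_apply, Finset.mul_sum]
    rw [Finset.sum_comm]
    simp only [← mul_assoc, ← Finset.sum_mul, ih, h.stationary]

theorem sum_pow_sq_le (h : HasGap π A l) (d : ℕ) {v : X → ℝ} (hv : ∑ i, π i * v i = 0) :
    ∑ i, π i * ((A ^ d) *ᵥ v) i ^ 2 ≤ (l ^ d) ^ 2 * ∑ i, π i * v i ^ 2 := by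
  induction d with
  | zero => simp
  | succ d ih =>
    have h0 : ∑ i, π i * ((A ^ d) *ᵥ v) i = 0 := (sum_mul_mulVec (h.pow_stationary d) v).trans hv
    have h1 := h.gap _ h0
    rw [Matrix.mulVec_mulVec, ← pow_succ'] at h1
    calc _ ≤ _ := h1
      _ ≤ l ^ 2 * ((l ^ d) ^ 2 * ∑ i, π i * v i ^ 2) := mul_le_mul_of_nonneg_left ih (sq_nonneg l)
      _ = _ := by ring

/-- The fluctuation kernel annihilates constants, so `v` may be centred, which does not increase its
`L_2(π)` norm. -/
theorem sum_fluct_sq_le (h : HasGap π A l) (d : ℕ) (v : X → ℝ) :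
    ∑ i, π i * (∑ j, ((A ^ d) i j - π j) * v j) ^ 2 ≤ (l ^ d) ^ 2 * ∑ i, π i * v i ^ 2 := by
  set m := ∑ i, π i * v i with hm
  have h0 : ∑ i, π i * (v i - m) = 0 := by
    simp only [mul_sub, Finset.sum_sub_distrib, ← Finset.sum_mul, h.law_sum]
    rw [← hm]
    ring
  have h1 : ∀ i, ∑ j, ((A ^ d) i j - π j) * v j = ((A ^ d) *ᵥ fun j => v j - m) i := fun i => by
    simp only [Matrix.mulVec, dotProduct, mul_sub, sub_mul, Finset.sum_sub_distrib,
      ← Finset.sum_mul, h.pow_row_sum, one_mul]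
    rw [← hm]
  simp only [h1]
  refine (h.sum_pow_sq_le d h0).trans (mul_le_mul_of_nonneg_left ?_ (sq_nonneg _))
  have h2 : ∑ i, π i * (v i - m) ^ 2 = ∑ i, π i * v i ^ 2 - m ^ 2 := by
    have : ∀ i, π i * (v i - m) ^ 2 = π i * v i ^ 2 - 2 * m * (π i * v i) + m ^ 2 * π i :=
      fun i => by ring
    simp only [this, Finset.sum_add_distrib, Finset.sum_sub_distrib, ← Finset.mul_sum, h.law_sum]
    rw [← hm]
    ring
  rw [h2]
  linarith [sq_nonneg m]

theorem sum_fluct_normSq_le (h : HasGap π A l) (d : ℕ) (v : X → ℂ) :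
    ∑ i, π i * ‖∑ j, (((A ^ d) i j - π j : ℝ) : ℂ) * v j‖ ^ 2 ≤ (l ^ d) ^ 2 * ∑ i, π i * ‖v i‖ ^ 2 := by
  have hn : ∀ z : ℂ, ‖z‖ ^ 2 = z.re ^ 2 + z.im ^ 2 := fun z => by
    rw [Complex.sq_norm, Complex.normSq_apply]
    ring
  have h1 := h.sum_fluct_sq_le d fun j => (v j).re
  have h2 := h.sum_fluct_sq_le d fun j => (v j).im
  simp only [hn, Complex.re_sum, Complex.im_sum, Complex.re_ofReal_mul, Complex.im_ofReal_mul,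
    mul_add, Finset.sum_add_distrib]
  linarith

theorem sum_abs_fluct_le (h : HasGap π A l) (d : ℕ) (i : X) : ∑ j, |(A ^ d) i j - π j| ≤ 2 := by
  calc ∑ j, |(A ^ d) i j - π j| ≤ ∑ j, ((A ^ d) i j + π j) := Finset.sum_le_sum fun j _ => by
        rw [abs_le]
        constructor <;> linarith [h.pow_nonneg d i j, h.law_nonneg j]
    _ = 2 := by
        rw [Finset.sum_add_distrib, h.pow_row_sum, h.law_sum]
        norm_num

theorem sum_mul_abs_fluct_le (h : HasGap π A l) (d : ℕ) (j : X) :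
    ∑ i, π i * |(A ^ d) i j - π j| ≤ 2 * π j := by
  calc ∑ i, π i * |(A ^ d) i j - π j| ≤ ∑ i, (π i * (A ^ d) i j + π i * π j) :=
        Finset.sum_le_sum fun i _ => by
          rw [← mul_add]
          refine mul_le_mul_of_nonneg_left ?_ (h.law_nonneg i)
          rw [abs_le]
          constructor <;> linarith [h.pow_nonneg d i j, h.law_nonneg j]
    _ = 2 * π j := by
        rw [Finset.sum_add_distrib, h.pow_stationary, ← Finset.sum_mul, h.law_sum]
        ring

/-- The endpoint `s = 0` of the interpolation; only row sums matter. -/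
theorem form_sup_one (h : HasGap π A l) (d : ℕ) {f g : X → ℂ} {u : X → ℝ} (hu : ∑ i, π i * u i ≤ 1)
    (hf : ∀ i, ‖f i‖ ≤ 1) (hg : ∀ i, ‖g i‖ ≤ u i) :
    ‖∑ j, ∑ i, ((π i * ((A ^ d) i j - π j) : ℝ) : ℂ) * (f j * g i)‖ ≤ 2 := by
  rw [Finset.sum_comm]
  calc _ ≤ ∑ i, ∑ j, ‖((π i * ((A ^ d) i j - π j) : ℝ) : ℂ) * (f j * g i)‖ :=
        (norm_sum_le _ _).trans (Finset.sum_le_sum fun i _ => norm_sum_le _ _)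
    _ ≤ ∑ i, ∑ j, (π i * u i) * |(A ^ d) i j - π j| := Finset.sum_le_sum fun i _ =>
        Finset.sum_le_sum fun j _ => by
          rw [norm_mul, norm_mul, Complex.norm_real, Real.norm_eq_abs, abs_mul,
            abs_of_nonneg (h.law_nonneg i)]
          have h1 : ‖f j‖ * ‖g i‖ ≤ 1 * u i :=
            mul_le_mul (hf j) (hg i) (norm_nonneg _) zero_le_one
          calc _ ≤ π i * |(A ^ d) i j - π j| * (1 * u i) :=
                mul_le_mul_of_nonneg_left h1 (mul_nonneg (h.law_nonneg i) (abs_nonneg _))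
            _ = _ := by ring
    _ ≤ ∑ i, (π i * u i) * 2 := Finset.sum_le_sum fun i _ => by
        rw [← Finset.mul_sum]
        exact mul_le_mul_of_nonneg_left (h.sum_abs_fluct_le d i)
          (mul_nonneg (h.law_nonneg i) ((norm_nonneg _).trans (hg i)))
    _ ≤ 2 := by
        rw [← Finset.sum_mul]
        linarith

/-- The endpoint `s = 1`; stationarity controls the `π`-weighted column sums. -/
theorem form_one_sup (h : HasGap π A l) (d : ℕ) {f g : X → ℂ} {u : X → ℝ} (hu : ∑ i, π i * u i ≤ 1)
    (hf : ∀ i, ‖f i‖ ≤ u i) (hg : ∀ i, ‖g i‖ ≤ 1) :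
    ‖∑ j, ∑ i, ((π i * ((A ^ d) i j - π j) : ℝ) : ℂ) * (f j * g i)‖ ≤ 2 := by
  calc _ ≤ ∑ j, ∑ i, ‖((π i * ((A ^ d) i j - π j) : ℝ) : ℂ) * (f j * g i)‖ :=
        (norm_sum_le _ _).trans (Finset.sum_le_sum fun i _ => norm_sum_le _ _)
    _ ≤ ∑ j, ∑ i, u j * (π i * |(A ^ d) i j - π j|) := Finset.sum_le_sum fun j _ =>
        Finset.sum_le_sum fun i _ => by
          rw [norm_mul, norm_mul, Complex.norm_real, Real.norm_eq_abs, abs_mul,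
            abs_of_nonneg (h.law_nonneg i)]
          have h1 : ‖f j‖ * ‖g i‖ ≤ u j * 1 :=
            mul_le_mul (hf j) (hg i) (norm_nonneg _) ((norm_nonneg _).trans (hf j))
          calc _ ≤ π i * |(A ^ d) i j - π j| * (u j * 1) :=
                mul_le_mul_of_nonneg_left h1 (mul_nonneg (h.law_nonneg i) (abs_nonneg _))
            _ = _ := by ring
    _ ≤ ∑ j, u j * (2 * π j) := Finset.sum_le_sum fun j _ => by
        rw [← Finset.mul_sum]
        exact mul_le_mul_of_nonneg_left (h.sum_mul_abs_fluct_le d j)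
          ((norm_nonneg _).trans (hf j))
    _ = 2 * ∑ j, π j * u j := by
        rw [Finset.mul_sum]
        exact Finset.sum_congr rfl fun j _ => by ring
    _ ≤ 2 := by linarith

/-- The midpoint `s = 1 / 2`, where the spectral gap enters, followed by Cauchy–Schwarz. -/
theorem form_two_two (h : HasGap π A l) (d : ℕ) {f g : X → ℂ}
    (hf : ∑ i, π i * ‖f i‖ ^ 2 ≤ 1) (hg : ∑ i, π i * ‖g i‖ ^ 2 ≤ 1) :
    ‖∑ j, ∑ i, ((π i * ((A ^ d) i j - π j) : ℝ) : ℂ) * (f j * g i)‖ ≤ l ^ d := by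
  rw [Finset.sum_comm]
  set G : X → ℂ := fun i => ∑ j, (((A ^ d) i j - π j : ℝ) : ℂ) * f j with hG
  have hl : 0 ≤ l ^ d := by have := h.pos; positivity
  have h1 : ∀ i, ∑ j, ((π i * ((A ^ d) i j - π j) : ℝ) : ℂ) * (f j * g i) = π i * (G i * g i) :=
    fun i => by
      rw [hG]
      simp only [Finset.sum_mul, Finset.mul_sum]
      exact Finset.sum_congr rfl fun j _ => by push_cast; ring
  simp only [h1]
  have h2 : ∑ i, π i * ‖G i‖ ^ 2 ≤ (l ^ d) ^ 2 :=
    (h.sum_fluct_normSq_le d f).trans (mul_le_of_le_one_right (sq_nonneg _) hf)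
  have h3 : (∑ i, π i * (‖G i‖ * ‖g i‖)) ^ 2 ≤ (∑ i, π i * ‖G i‖ ^ 2) * ∑ i, π i * ‖g i‖ ^ 2 :=
    Finset.sum_sq_le_sum_mul_sum_of_sq_le_mul _
      (fun i _ => mul_nonneg (h.law_nonneg i) (sq_nonneg _))
      (fun i _ => mul_nonneg (h.law_nonneg i) (sq_nonneg _)) fun i _ => le_of_eq (by ring)
  have h4 : (∑ i, π i * (‖G i‖ * ‖g i‖)) ^ 2 ≤ (l ^ d) ^ 2 := by
    refine h3.trans (le_trans (mul_le_of_le_one_right ?_ hg) h2)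
    exact Finset.sum_nonneg fun i _ => mul_nonneg (h.law_nonneg i) (sq_nonneg _)
  refine le_trans ?_ ((le_abs_self _).trans (abs_le_of_sq_le_sq h4 hl))
  refine (norm_sum_le _ _).trans (le_of_eq (Finset.sum_congr rfl fun i _ => ?_))
  rw [norm_mul, norm_mul, Complex.norm_real, Real.norm_of_nonneg (h.law_nonneg i)]

end HasGap

/-- On `L_{1/s}(π)` the fluctuation of `A ^ d` decays like `l ^ (2 d min (s, 1 - s))`. -/
theorem PowBall.fluct (h : HasGap π A l) (d : ℕ) {s c : ℝ} (hs : 0 < s) (hs1 : s < 1)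
    {f : X → ℝ} (hf : PowBall π s c f) (hc : 0 ≤ c) :
    PowBall π s (2 * (l ^ d) ^ (2 * min s (1 - s)) * c)
      fun i => ((A ^ d) *ᵥ f) i - ∑ j, π j * f j := by
  have hl : 0 < l ^ d := pow_pos h.pos d
  -- A one-point second space with exponent `0` reduces the mixed balls to those of `L_{1/σ}(π)`.
  have hball : ∀ {σ : ℝ} {f : X → Unit → ℂ}, MixedBall π (fun _ : Unit => (1 : ℝ)) σ 0 f →
      ∃ u : X → ℝ, (∀ i, 0 ≤ u i) ∧ ∑ i, π i * u i ≤ 1 ∧ ∀ i, ‖f i ()‖ ≤ u i ^ σ := by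
    rintro σ f ⟨u, v, hu, -, hau, -, hle⟩
    exact ⟨u, hu, hau, fun i => by simpa using hle i ()⟩
  have hball' : ∀ {σ : ℝ} {f : X → ℝ}, PowBall π σ 1 f →
      MixedBall π (fun _ : Unit => (1 : ℝ)) σ 0 (fun i _ => (f i : ℂ)) := by
    rintro σ f ⟨u, hu, hau, hle⟩
    exact ⟨u, fun _ _ => 1, hu, fun _ _ => zero_le_one, hau, by simp, fun i _ => by
      simpa using hle i⟩
  have hhalf : ∀ {f : X → Unit → ℂ}, MixedBall π (fun _ : Unit => (1 : ℝ)) (1 / 2) 0 f →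
      ∑ i, π i * ‖f i ()‖ ^ 2 ≤ 1 := fun hf => by
    obtain ⟨u, hu, hau, hle⟩ := hball hf
    refine le_trans (Finset.sum_le_sum fun i _ => mul_le_mul_of_nonneg_left ?_ (h.law_nonneg i)) hau
    calc _ ≤ (u i ^ (1 / 2 : ℝ)) ^ 2 := pow_le_pow_left₀ (norm_nonneg _) (hle i) 2
      _ = u i := by rw [← Real.sqrt_eq_rpow, Real.sq_sqrt (hu i)]
  have hmain : ∀ f g : X → ℝ, PowBall π s 1 f → PowBall π (1 - s) 1 g →
      ∑ i, π i * ((((A ^ d) *ᵥ f) i - ∑ j, π j * f j) * g i) ≤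
        2 * (l ^ d) ^ (2 * min s (1 - s)) := by
    intro f g hf hg
    have heq : ((∑ i, π i * ((((A ^ d) *ᵥ f) i - ∑ j, π j * f j) * g i) : ℝ) : ℂ) =
        ∑ j, ∑ _ : Unit, ∑ i, ∑ _ : Unit,
          ((π i * ((A ^ d) i j - π j) : ℝ) : ℂ) * ((f j : ℂ) * (g i : ℂ)) := by
      simp only [Finset.univ_unique, Finset.sum_singleton]
      rw [Finset.sum_comm]
      push_cast
      refine Finset.sum_congr rfl fun i _ => ?_
      simp only [Matrix.mulVec, dotProduct]
      push_cast
      rw [← Finset.sum_sub_distrib, Finset.sum_mul, Finset.mul_sum]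
      exact Finset.sum_congr rfl fun j _ => by ring
    refine (le_abs_self _).trans ?_
    rw [← Real.norm_eq_abs, ← Complex.norm_real, heq]
    have hhalf2 : ∀ f g : X → Unit → ℂ, MixedBall π (fun _ : Unit => (1 : ℝ)) (1 / 2) 0 f →
        MixedBall π (fun _ : Unit => (1 : ℝ)) (1 / 2) 0 g → ‖∑ j, ∑ y : Unit, ∑ i, ∑ t : Unit,
          ((π i * ((A ^ d) i j - π j) : ℝ) : ℂ) * (f j y * g i t)‖ ≤ l ^ d := fun f g hf hg => by
      simpa using h.form_two_two d (hhalf hf) (hhalf hg)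
    have hfin : ∀ θ : ℝ, 0 ≤ θ → θ ≤ 1 → (2 : ℝ) ^ (1 - θ) * (l ^ d) ^ θ ≤ 2 * (l ^ d) ^ θ :=
      fun θ h0 h1 => by
        refine mul_le_mul_of_nonneg_right ?_ (Real.rpow_nonneg hl.le _)
        calc (2 : ℝ) ^ (1 - θ) ≤ 2 ^ (1 : ℝ) :=
              Real.rpow_le_rpow_of_exponent_le (by norm_num) (by linarith)
          _ = 2 := Real.rpow_one 2
    -- Interpolate from `0` to `1 / 2` with `θ = 2 s`, or from `1` to `1 / 2` with `θ = 2 (1 - s)`;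
    -- in both cases `θ = 2 min (s, 1 - s)`.
    rcases le_total s (1 / 2) with hs2 | hs2
    · have hmin : 2 * min s (1 - s) = 2 * s := by rw [min_eq_left (by linarith)]
      rw [hmin]
      refine le_trans ?_ (hfin (2 * s) (by linarith) (by linarith))
      refine MixedBall.riesz_thorin (a := π) (b := fun _ => 1) (w := π) (b' := fun _ => 1)
        (fun j _ i _ => ((π i * ((A ^ d) i j - π j) : ℝ) : ℂ)) (s₀ := 0) (s₁ := 1 / 2) (r₀ := 0)
        (r₁ := 0) (σ₀ := 1) (σ₁ := 1 / 2) (ρ₀ := 0) (ρ₁ := 0) le_rfl (by norm_num) le_rfl le_rfl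
        zero_le_one (by norm_num) le_rfl le_rfl (by linarith) (by linarith) ?_ hhalf2 ?_ ?_
      · intro f g hf hg
        obtain ⟨u, hu, hau, hle⟩ := hball hf
        obtain ⟨u', hu', hau', hle'⟩ := hball hg
        simpa using h.form_sup_one d hau' (by simpa using hle) (by simpa using hle')
      · convert hball' hf using 1 <;> ring
      · convert hball' hg using 1 <;> ring
    · have hmin : 2 * min s (1 - s) = 2 * (1 - s) := by rw [min_eq_right (by linarith)]
      rw [hmin]
      refine le_trans ?_ (hfin (2 * (1 - s)) (by linarith) (by linarith))
      refine MixedBall.riesz_thorin (a := π) (b := fun _ => 1) (w := π) (b' := fun _ => 1)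
        (fun j _ i _ => ((π i * ((A ^ d) i j - π j) : ℝ) : ℂ)) (s₀ := 1) (s₁ := 1 / 2) (r₀ := 0)
        (r₁ := 0) (σ₀ := 0) (σ₁ := 1 / 2) (ρ₀ := 0) (ρ₁ := 0) zero_le_one (by norm_num) le_rfl le_rfl
        le_rfl (by norm_num) le_rfl le_rfl (by linarith) (by linarith) ?_ hhalf2 ?_ ?_
      · intro f g hf hg
        obtain ⟨u, hu, hau, hle⟩ := hball hf
        obtain ⟨u', hu', hau', hle'⟩ := hball hg
        simpa using h.form_one_sup d hau (by simpa using hle) (by simpa using hle')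
      · convert hball' hf using 1 <;> ring
      · convert hball' hg using 1 <;> ring
  rcases hc.eq_or_lt with rfl | hc
  · obtain ⟨u, hu, hau, hle⟩ := hf
    have h0 : f = 0 := funext fun i => by simpa using hle i
    exact ⟨u, hu, hau, fun i => by simp [h0]⟩
  refine PowBall.of_dual h.law_nonneg hs (by positivity) fun g hg => ?_
  have h1 : PowBall π s 1 fun i => c⁻¹ * f i := by
    simpa [abs_of_pos hc, hc.ne'] using hf.const_mul c⁻¹
  have h2 := hmain _ g h1 hg
  have h3 : ∀ i, ((A ^ d) *ᵥ fun i => c⁻¹ * f i) i - ∑ j, π j * (c⁻¹ * f j) =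
      c⁻¹ * (((A ^ d) *ᵥ f) i - ∑ j, π j * f j) := fun i => by
    simp only [Matrix.mulVec, dotProduct, mul_sub, Finset.mul_sum]
    congr 1 <;> exact Finset.sum_congr rfl fun j _ => by ring
  simp only [h3] at h2
  have h4 : ∑ i, π i * (c⁻¹ * (((A ^ d) *ᵥ f) i - ∑ j, π j * f j) * g i) =
      c⁻¹ * ∑ i, π i * ((((A ^ d) *ᵥ f) i - ∑ j, π j * f j) * g i) := by
    rw [Finset.mul_sum]
    exact Finset.sum_congr rfl fun i _ => by ring
  rw [h4, inv_mul_le_iff₀ hc] at h2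
  linarith

end MarkovConcentration

namespace MarkovConcentration

/-! ### Moments of sums along a chain -/

/-- `condMoment A f L k i` is the expectation of `(f W₀ + ⋯ + f W_{L-1}) ^ k / k!` for the chain
with transition matrix `A` started at `i`. -/
noncomputable def condMoment {X : Type*} [Fintype X] (A : Matrix X X ℝ) (f : X → ℝ) :
    ℕ → ℕ → X → ℝ
  | 0, k => fun _ => if k = 0 then 1 else 0
  | L + 1, k => fun i => ∑ j ∈ Finset.range (k + 1),
      f i ^ j / j.factorial * (A *ᵥ condMoment A f L (k - j)) i

/-- The terms of `condMoment A f (L + 1) k` in which the first state occurs. -/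
noncomputable def condMomentRest {X : Type*} [Fintype X] (A : Matrix X X ℝ) (f : X → ℝ)
    (L k : ℕ) (i : X) : ℝ :=
  ∑ j ∈ Finset.range k,
    f i ^ (j + 1) / (j + 1).factorial * (A *ᵥ condMoment A f L (k - (j + 1))) i

theorem sum_inv_factorial_le (k : ℕ) :
    ∑ j ∈ Finset.range k, (1 : ℝ) / (j + 2).factorial ≤ 1 := by
  have h : ∀ k, ∑ j ∈ Finset.range k, (1 : ℝ) / (j + 2).factorial ≤ 1 - 1 / (k + 1).factorial := by
    intro k
    induction k with
    | zero => simp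
    | succ k ih =>
      rw [Finset.sum_range_succ]
      have h1 : ((k + 2).factorial : ℝ) = (k + 2) * (k + 1).factorial := by
        rw [Nat.factorial_succ (k + 1)]
        push_cast
        ring
      have h2 : (0 : ℝ) < (k + 1).factorial := by positivity
      have h3 : 2 * ((1 : ℝ) / (k + 2).factorial) ≤ 1 / (k + 1).factorial := by
        rw [h1, mul_one_div, div_le_div_iff₀ (by positivity) h2]
        nlinarith [mul_nonneg (Nat.cast_nonneg (α := ℝ) k) h2.le]
      linarith
  have h1 : (0 : ℝ) ≤ 1 / (k + 1).factorial := by positivity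
  linarith [h k]

theorem sum_exp_le {y : ℝ} (hy : 0 < y) (L : ℕ) :
    ∑ i ∈ Finset.range L, Real.exp (y * i) ≤ Real.exp (y * L) / y := by
  induction L with
  | zero => simp [hy.le]
  | succ L ih =>
    rw [Finset.sum_range_succ]
    have h1 : Real.exp (y * (L + 1 : ℕ)) = Real.exp (y * L) * Real.exp y := by
      rw [← Real.exp_add]
      push_cast
      ring_nf
    have h2 := Real.add_one_le_exp y
    rw [h1]
    calc _ ≤ Real.exp (y * L) / y + Real.exp (y * L) := by linarith
      _ = Real.exp (y * L) * (y + 1) / y := by field_simp; ring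
      _ ≤ _ := by gcongr

/-- Bernoulli's inequality `l ^ θ ≤ 1 - θ (1 - l)`, inserted into the geometric series. -/
theorem sum_rpow_pow_le {l θ : ℝ} (hl : 0 < l) (hl1 : l < 1) (hθ : 0 < θ) (hθ1 : θ ≤ 1) (L : ℕ) :
    ∑ d ∈ Finset.range L, (l ^ d) ^ θ ≤ 1 / (1 - l) / θ := by
  have h1 : l ^ θ ≤ 1 - θ * (1 - l) := by
    have h := rpow_one_add_le_one_add_mul_self (s := l - 1) (by linarith) hθ.le hθ1
    simp only [add_sub_cancel] at h
    linarith
  have h2 : 0 < θ * (1 - l) := mul_pos hθ (by linarith)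
  have h3 : 0 ≤ l ^ θ := by positivity
  have h4 : ∀ d : ℕ, (l ^ d) ^ θ = (l ^ θ) ^ d := fun d => by
    rw [← Real.rpow_natCast, ← Real.rpow_natCast, ← Real.rpow_mul hl.le, ← Real.rpow_mul hl.le,
      mul_comm]
  simp only [h4]
  have h5 := mul_neg_geom_sum (l ^ θ) L
  have h6 : 0 ≤ (l ^ θ) ^ L := by positivity
  have h7 : (1 - l ^ θ) * ∑ d ∈ Finset.range L, (l ^ θ) ^ d ≤ 1 := by linarith
  have h8 : 0 ≤ ∑ d ∈ Finset.range L, (l ^ θ) ^ d := Finset.sum_nonneg fun d _ => by positivity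
  have h9 : 0 < 1 - l := by linarith
  rw [div_div, le_div_iff₀ (by positivity)]
  nlinarith

variable {X : Type*} [Fintype X] {π : X → ℝ} {A : Matrix X X ℝ} {l : ℝ} {f : X → ℝ}

theorem condMoment_succ (L k : ℕ) :
    condMoment A f (L + 1) k = A *ᵥ condMoment A f L k + condMomentRest A f L k := by
  funext i
  simp only [condMoment, Pi.add_apply, condMomentRest]
  rw [Finset.sum_range_succ']
  simp [add_comm]

/-- Iterating `condMoment_succ` down to `L = 0`, where moments of nonzero order vanish. This exposes
the powers `A ^ d`, to which `PowBall.fluct` applies, acting on expressions in lower moments. -/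
theorem condMoment_eq_sum [DecidableEq X] {k : ℕ} (hk : k ≠ 0) (L : ℕ) :
    condMoment A f L k =
      ∑ d ∈ Finset.range L, (A ^ d) *ᵥ condMomentRest A f (L - 1 - d) k := by
  induction L with
  | zero => funext i; simp [condMoment, hk]
  | succ L ih =>
    rw [condMoment_succ, Finset.sum_range_succ', ih, Matrix.mulVec_sum]
    simp only [pow_zero, Matrix.one_mulVec, Nat.sub_zero, Nat.add_sub_cancel]
    congr 1
    refine Finset.sum_congr rfl fun d _ => ?_
    rw [Matrix.mulVec_mulVec, ← pow_succ', show L - (d + 1) = L - 1 - d by omega]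

theorem condMoment_zero (hr : ∀ i, ∑ j, A i j = 1) (L : ℕ) : condMoment A f L 0 = fun _ => 1 := by
  induction L with
  | zero => rfl
  | succ L ih =>
    rw [condMoment_succ, ih, mulVec_const hr]
    funext i
    simp [condMomentRest]

/-- The growth rate of the bound for `condMoment`. -/
noncomputable def growth (q : ℕ) (ρ : ℝ) (k : ℕ) : ℝ :=
  ∏ i ∈ Finset.range k, ρ * (4 * q ^ 2 / ((i + 1) * (q - (i + 1))))

/-- From `i (q - i) ≤ q² / 4`. The factor 16 leaves room for the numerical constants of the
induction. -/
theorem growth_step {q : ℕ} {ρ : ℝ} (hρ : 1 ≤ ρ) {k : ℕ} (hk : k + 1 < q) :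
    16 * ρ ≤ ρ * (4 * q ^ 2 / ((k + 1) * (q - (k + 1)))) := by
  have h1 : ((k : ℝ) + 1) < q := by exact_mod_cast hk
  have h2 : (0 : ℝ) < q - (k + 1) := by linarith
  have h3 : (16 : ℝ) ≤ 4 * q ^ 2 / ((k + 1) * (q - (k + 1))) := by
    rw [le_div_iff₀ (by positivity)]
    nlinarith [sq_nonneg ((q : ℝ) - 2 * (k + 1))]
  nlinarith

theorem growth_pos {q : ℕ} {ρ : ℝ} (hρ : 1 ≤ ρ) {k : ℕ} (hk : k < q) : 0 < growth q ρ k := by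
  refine Finset.prod_pos fun i hi => ?_
  have h := growth_step (q := q) hρ (k := i) (by have := Finset.mem_range.1 hi; omega)
  linarith

theorem growth_succ (q : ℕ) (ρ : ℝ) (k : ℕ) :
    growth q ρ (k + 1) = growth q ρ k * (ρ * (4 * q ^ 2 / ((k + 1) * (q - (k + 1))))) :=
  Finset.prod_range_succ _ _

theorem mul_growth_le {q : ℕ} {ρ : ℝ} (hρ : 1 ≤ ρ) {k : ℕ} (hk : k + 1 < q) :
    16 * ρ * growth q ρ k ≤ growth q ρ (k + 1) := by
  rw [growth_succ, mul_comm]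
  exact mul_le_mul_of_nonneg_left (growth_step hρ hk) (growth_pos hρ (by omega)).le

theorem growth_le_growth {q : ℕ} {ρ : ℝ} (hρ : 1 ≤ ρ) {j k : ℕ} (hjk : j ≤ k) (hk : k < q) :
    growth q ρ j ≤ growth q ρ k := by
  induction k with
  | zero => rw [Nat.le_zero.1 hjk]
  | succ k ih =>
    rcases hjk.eq_or_lt with rfl | h
    · exact le_rfl
    · have h1 := mul_growth_le hρ hk
      have h2 := growth_pos (q := q) hρ (k := k) (by omega)
      have h3 := ih (by omega) (by omega)
      nlinarith

/-- The inductive bound for the mean and the fluctuation of `condMoment`. -/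
def MomentBound (π : X → ℝ) (A : Matrix X X ℝ) (f : X → ℝ) (q : ℕ) (D ρ y : ℝ) (k : ℕ) : Prop :=
  ∀ L : ℕ, |∑ i, π i * condMoment A f L k i| ≤ growth q ρ k * Real.exp (y * L) ∧
    PowBall π (k / q) (D / ρ * growth q ρ k * Real.exp (y * L))
      fun i => condMoment A f L k i - ∑ j, π j * condMoment A f L k j

theorem MomentBound.powBall (h : HasGap π A l) {q : ℕ} {D ρ y : ℝ} (hD : 1 ≤ D) (hρ : D ≤ ρ)
    {k : ℕ} (hk : k < q) (hM : MomentBound π A f q D ρ y k) (L : ℕ) :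
    PowBall π (k / q) (2 * (growth q ρ k * Real.exp (y * L))) (condMoment A f L k) := by
  obtain ⟨h1, h2⟩ := hM L
  have hg := growth_pos (q := q) (hD.trans hρ) hk
  have hρ0 : 0 < ρ := by linarith
  have hkq : (k : ℝ) / q ≤ 1 := div_le_one_of_le₀ (by exact_mod_cast hk.le) (by positivity)
  have h3 := h2.add (PowBall.const h.law_sum.le (k / q) h1) (by positivity) hkq
    (by positivity) (by positivity)
  simp only [sub_add_cancel] at h3
  refine h3.mono ?_
  have h4 : D / ρ ≤ 1 := div_le_one_of_le₀ hρ hρ0.le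
  have h5 : 0 ≤ growth q ρ k * Real.exp (y * L) := by positivity
  nlinarith

/-- Hölder with exponents `(j + 1) / q` for the power of `f` and `k / q` for `A *ᵥ g`. -/
theorem powBall_term (h : HasGap π A l) {q : ℕ} (hf : PowBall π (1 / q) 1 f) {k j : ℕ}
    (hk : k + j + 1 ≤ q) {c : ℝ} (hc : 0 ≤ c) {g : X → ℝ} (hg : PowBall π (k / q) c g) :
    PowBall π ((k + j + 1 : ℕ) / q) (1 / (j + 1).factorial * c)
      fun i => f i ^ (j + 1) / (j + 1).factorial * (A *ᵥ g) i := by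
  have hq : (0 : ℝ) < q := by
    have : 0 < q := by omega
    exact_mod_cast this
  have hkq : (k : ℝ) / q ≤ 1 := div_le_one_of_le₀ (by exact_mod_cast (by omega)) hq.le
  have h1 := ((hf.pow (j + 1)).mul (hg.mulVec h (by positivity) hkq hc)
    (by positivity) (by positivity) (by positivity) zero_le_one hc).const_mul
      (1 / (j + 1).factorial : ℝ)
  rw [abs_of_nonneg (by positivity), one_mul] at h1
  convert h1 using 1
  · push_cast
    field_simp
    ring
  · funext i
    ring

/-- Minkowski over the terms of `powBall_term`. The lower moments cost `2` (mean plus fluctuation)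
and the factorials sum to at most `2`, whence `4`. -/
theorem powBall_condMomentRest (h : HasGap π A l) {q : ℕ} (hf : PowBall π (1 / q) 1 f)
    {D ρ y : ℝ} (hD : 1 ≤ D) (hρ : D ≤ ρ) {k : ℕ} (hk : k + 1 ≤ q)
    (hM : ∀ k' ≤ k, MomentBound π A f q D ρ y k') (L : ℕ) :
    PowBall π ((k + 1 : ℕ) / q) (4 * (growth q ρ k * Real.exp (y * L)))
      (condMomentRest A f L (k + 1)) := by
  have hg := growth_pos (q := q) (hD.trans hρ) (k := k) (by omega)
  have hkq : ((k + 1 : ℕ) : ℝ) / q ≤ 1 :=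
    div_le_one_of_le₀ (by exact_mod_cast hk) (by positivity)
  have h1 : ∀ j ∈ Finset.range (k + 1), PowBall π ((k + 1 : ℕ) / q)
      (1 / (j + 1).factorial * (2 * (growth q ρ k * Real.exp (y * L))))
      fun i => f i ^ (j + 1) / (j + 1).factorial * (A *ᵥ condMoment A f L (k + 1 - (j + 1))) i := by
    intro j hj
    have hj' := Finset.mem_range.1 hj
    have h2 := (hM (k + 1 - (j + 1)) (by omega)).powBall h hD hρ (by omega) L
    have h3 := powBall_term h hf (j := j) (by omega) (c := 2 * (growth q ρ k * Real.exp (y * L)))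
      (by positivity) (h2.mono (by
        have := growth_le_growth (q := q) (hD.trans hρ) (j := k + 1 - (j + 1)) (k := k)
          (by omega) (by omega)
        gcongr))
    rwa [show k + 1 - (j + 1) + j + 1 = k + 1 by omega] at h3
  have h2 := PowBall.sum (Finset.range (k + 1)) h1 (by positivity) hkq fun j _ => by positivity
  refine h2.mono ?_
  rw [← Finset.sum_mul, Finset.sum_range_succ']
  have h3 := sum_inv_factorial_le k
  have h4 : 0 ≤ growth q ρ k * Real.exp (y * L) := by positivity
  simp only [zero_add, Nat.factorial_one, Nat.cast_one, div_one]
  nlinarith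

/-- This is the cancellation. Since `f` is centred, the lower moment in the linear term may be
replaced by its fluctuation, which carries the small factor `D / ρ`. The terms of degree at least 2
in `f` involve moments of order at most `k - 1`, and one step of `growth` pays for the factor `1 /
ρ`. The two parts contribute `1` and `2` to the constant `3`. -/
theorem abs_mean_condMomentRest_le (h : HasGap π A l) {q : ℕ} (hf : PowBall π (1 / q) 1 f)
    (hf0 : ∑ i, π i * f i = 0)
    {D ρ y : ℝ} (hD : 1 ≤ D) (hρ : D ≤ ρ) {k : ℕ} (hk : k + 1 ≤ q)
    (hM : ∀ k' ≤ k, MomentBound π A f q D ρ y k') (L : ℕ) :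
    |∑ i, π i * condMomentRest A f L (k + 1) i| ≤
      3 * (D / ρ * growth q ρ k * Real.exp (y * L)) := by
  have hg := growth_pos (q := q) (hD.trans hρ) (k := k) (by omega)
  have hρ0 : 0 < ρ := by linarith
  have hkq : ((k + 1 : ℕ) : ℝ) / q ≤ 1 :=
    div_le_one_of_le₀ (by exact_mod_cast hk) (by positivity)
  have hmean : ∀ {c : ℝ} {g : X → ℝ}, 0 ≤ c → PowBall π ((k + 1 : ℕ) / q) c g →
      |∑ i, π i * g i| ≤ c := fun hc hg =>
    hg.abs_mean_le h.law_nonneg h.law_sum (by positivity) hkq hc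
  have hsplit : ∑ i, π i * condMomentRest A f L (k + 1) i =
      ∑ j ∈ Finset.range k, (∑ i, π i * (f i ^ (j + 1 + 1) / (j + 1 + 1).factorial *
        (A *ᵥ condMoment A f L (k + 1 - (j + 1 + 1))) i)) +
      ∑ i, π i * (f i ^ (0 + 1) / (0 + 1).factorial * (A *ᵥ fun i => condMoment A f L k i -
        ∑ j, π j * condMoment A f L k j) i) := by
    have h1 : ∑ i, π i * (f i ^ (0 + 1) / (0 + 1).factorial * (A *ᵥ fun i => condMoment A f L k i -
        ∑ j, π j * condMoment A f L k j) i) =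
        ∑ i, π i * (f i ^ (0 + 1) / (0 + 1).factorial * (A *ᵥ condMoment A f L k) i) := by
      have h2 : ∀ i, (A *ᵥ fun i => condMoment A f L k i - ∑ j, π j * condMoment A f L k j) i =
          (A *ᵥ condMoment A f L k) i - ∑ j, π j * condMoment A f L k j := fun i => by
        have h3 := congrFun (Matrix.mulVec_sub A (condMoment A f L k)
          (fun _ => ∑ j, π j * condMoment A f L k j)) i
        rw [mulVec_const h.row_sum] at h3
        exact h3
      simp only [h2, mul_sub, Finset.sum_sub_distrib]
      rw [sub_eq_self]
      simp only [zero_add, pow_one, Nat.factorial_one, Nat.cast_one, div_one, ← mul_assoc]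
      rw [← Finset.sum_mul, hf0, zero_mul]
    rw [h1]
    simp only [condMomentRest]
    simp_rw [Finset.sum_range_succ' _ k, mul_add, Finset.sum_add_distrib, Finset.mul_sum]
    rw [Finset.sum_comm]
    simp
  rw [hsplit]
  have h0 := hmean (by positivity) (powBall_term h hf (j := 0) hk (by positivity) (hM k le_rfl L).2)
  have h1 : ∀ j ∈ Finset.range k, |∑ i, π i * (f i ^ (j + 1 + 1) / (j + 1 + 1).factorial *
        (A *ᵥ condMoment A f L (k + 1 - (j + 1 + 1))) i)| ≤
        1 / (j + 2).factorial * (2 * (1 / ρ * growth q ρ k * Real.exp (y * L))) := by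
    intro j hj
    have hj' := Finset.mem_range.1 hj
    have h2 := (hM (k + 1 - (j + 1 + 1)) (by omega)).powBall h hD hρ (by omega) L
    have h3 := powBall_term h hf (j := j + 1) (by omega)
      (c := 2 * (1 / ρ * growth q ρ k * Real.exp (y * L)))
      (by positivity) (h2.mono (by
        have h5 := growth_le_growth (q := q) (hD.trans hρ) (j := k + 1 - (j + 1 + 1)) (k := k - 1)
          (by omega) (by omega)
        have h6 := mul_growth_le (q := q) (hD.trans hρ) (k := k - 1) (by omega)
        have h8 := growth_pos (q := q) (hD.trans hρ) (k := k - 1) (by omega)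
        rw [show k - 1 + 1 = k by omega] at h6
        have h7 : growth q ρ (k + 1 - (j + 1 + 1)) ≤ 1 / ρ * growth q ρ k := by
          rw [one_div, le_inv_mul_iff₀ hρ0]
          nlinarith
        gcongr))
    rw [show k + 1 - (j + 1 + 1) + (j + 1) + 1 = k + 1 by omega] at h3
    exact hmean (by positivity) h3
  have h2 := (Finset.abs_sum_le_sum_abs _ _).trans (Finset.sum_le_sum h1)
  rw [← Finset.sum_mul] at h2
  have h3 := sum_inv_factorial_le k
  have h4 : 0 ≤ 1 / ρ * growth q ρ k * Real.exp (y * L) := by positivity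
  have h5 : D / ρ * growth q ρ k * Real.exp (y * L) =
      D * (1 / ρ * growth q ρ k * Real.exp (y * L)) := by ring
  refine (abs_add_le _ _).trans ((add_le_add h2 h0).trans ?_)
  simp only [zero_add, Nat.factorial_one, Nat.cast_one, div_one]
  rw [h5]
  nlinarith

/-- Stationarity removes `A ^ d` from the means, so no decay is needed and `k + 1 = q` is allowed.
Summing the exponentials costs `1 / y = ρ² / D`, which turns the factor `D / ρ` into `ρ`. -/
theorem abs_mean_condMoment_le (h : HasGap π A l) {q : ℕ} (hf : PowBall π (1 / q) 1 f)
    (hf0 : ∑ i, π i * f i = 0)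
    {D ρ y : ℝ} (hD : 1 ≤ D) (hρ : D ≤ ρ) (hy : y = D / ρ ^ 2) {k : ℕ} (hk : k + 1 ≤ q)
    (hM : ∀ k' ≤ k, MomentBound π A f q D ρ y k') (L : ℕ) :
    |∑ i, π i * condMoment A f L (k + 1) i| ≤ 3 * ρ * growth q ρ k * Real.exp (y * L) := by
  classical
  have hg := growth_pos (q := q) (hD.trans hρ) (k := k) (by omega)
  have hρ0 : 0 < ρ := by linarith
  have hy0 : 0 < y := by rw [hy]; positivity
  have h1 : ∑ i, π i * condMoment A f L (k + 1) i =
      ∑ d ∈ Finset.range L, ∑ i, π i * condMomentRest A f (L - 1 - d) (k + 1) i := by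
    rw [condMoment_eq_sum k.succ_ne_zero]
    simp only [Finset.sum_apply, Finset.mul_sum]
    rw [Finset.sum_comm]
    exact Finset.sum_congr rfl fun d _ => sum_mul_mulVec (h.pow_stationary d) _
  rw [h1, Finset.sum_range_reflect (fun d => ∑ i, π i * condMomentRest A f d (k + 1) i)]
  calc _ ≤ ∑ d ∈ Finset.range L, 3 * (D / ρ * growth q ρ k * Real.exp (y * d)) :=
        (Finset.abs_sum_le_sum_abs _ _).trans (Finset.sum_le_sum fun d _ =>
          abs_mean_condMomentRest_le h hf hf0 hD hρ hk hM d)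
    _ = 3 * (D / ρ * growth q ρ k) * ∑ d ∈ Finset.range L, Real.exp (y * d) := by
        rw [Finset.mul_sum]
        exact Finset.sum_congr rfl fun d _ => by ring
    _ ≤ 3 * (D / ρ * growth q ρ k) * (Real.exp (y * L) / y) := by
        have := sum_exp_le hy0 L
        gcongr
    _ = _ := by
        rw [hy]
        have : D ≠ 0 := by linarith
        field_simp

/-- Here `k + 1 < q` keeps `s` below 1, where the fluctuations decay. The factors `4` (remainder),
`2` (interpolation) and `D / (2 min (s, 1 - s))` (sum over `d`) multiply to `4 D / min (s, 1 - s)`.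
As `min (s, 1 - s) ≥ s (1 - s)`, this is at most `D / ρ` times the next factor of `growth`. -/
theorem powBall_fluct_condMoment (h : HasGap π A l) {q : ℕ} (hf : PowBall π (1 / q) 1 f)
    {D ρ y : ℝ} (hDl : D = 1 / (1 - l)) (hD : 1 ≤ D) (hρ : D ≤ ρ) (hy : 0 ≤ y) {k : ℕ}
    (hk : k + 1 < q) (hM : ∀ k' ≤ k, MomentBound π A f q D ρ y k') (L : ℕ) :
    PowBall π ((k + 1 : ℕ) / q) (D / ρ * growth q ρ (k + 1) * Real.exp (y * L))
      fun i => condMoment A f L (k + 1) i - ∑ j, π j * condMoment A f L (k + 1) j := by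
  classical
  have hg := growth_pos (q := q) (hD.trans hρ) (k := k) (by omega)
  have hρ0 : 0 < ρ := by linarith
  have hD0 : 0 < D := by linarith
  have hq : (0 : ℝ) < q := by
    have : 0 < q := by omega
    exact_mod_cast this
  have hkq : ((k : ℝ) + 1) < q := by exact_mod_cast hk
  set s : ℝ := ((k + 1 : ℕ) : ℝ) / q with hs
  have hs0 : 0 < s := by positivity
  have hs1 : s < 1 := by
    rw [hs, div_lt_one hq]
    exact_mod_cast hk
  have hθ0 : 0 < 2 * min s (1 - s) := mul_pos two_pos (lt_min hs0 (by linarith))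
  have hθ1 : 2 * min s (1 - s) ≤ 1 := by
    rcases min_le_iff.1 (le_refl (min s (1 - s))) with h | h <;>
    linarith [min_le_left s (1 - s), min_le_right s (1 - s)]
  have hl := h.pos
  have h1 : (fun i => condMoment A f L (k + 1) i - ∑ j, π j * condMoment A f L (k + 1) j) =
      fun i => ∑ d ∈ Finset.range L, (((A ^ d) *ᵥ condMomentRest A f (L - 1 - d) (k + 1)) i -
        ∑ j, π j * condMomentRest A f (L - 1 - d) (k + 1) j) := by
    funext i
    rw [condMoment_eq_sum k.succ_ne_zero]
    simp only [Finset.sum_apply, Finset.mul_sum, Finset.sum_sub_distrib]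
    congr 1
    rw [Finset.sum_comm]
    exact Finset.sum_congr rfl fun d _ => sum_mul_mulVec (h.pow_stationary d) _
  rw [h1]
  have h2 := PowBall.sum (Finset.range L) (fun d _ => PowBall.fluct h d hs0 hs1
    (powBall_condMomentRest h hf hD hρ hk.le hM (L - 1 - d)) (by positivity)) hs0.le hs1.le
    fun d _ => by positivity
  refine h2.mono ?_
  calc _ ≤ ∑ d ∈ Finset.range L, (8 * (growth q ρ k * Real.exp (y * L))) *
        (l ^ d) ^ (2 * min s (1 - s)) := by
        refine Finset.sum_le_sum fun d hd => ?_
        have hd' : ((L - 1 - d : ℕ) : ℝ) ≤ L := by exact_mod_cast (by omega)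
        have h3 : Real.exp (y * (L - 1 - d : ℕ)) ≤ Real.exp (y * L) :=
          Real.exp_le_exp.2 (mul_le_mul_of_nonneg_left hd' hy)
        have h4 : 0 ≤ (l ^ d) ^ (2 * min s (1 - s)) := by positivity
        calc _ ≤ 2 * (l ^ d) ^ (2 * min s (1 - s)) * (4 * (growth q ρ k * Real.exp (y * L))) := by
              gcongr
          _ = _ := by ring
    _ ≤ (8 * (growth q ρ k * Real.exp (y * L))) * (D / (2 * min s (1 - s))) := by
        rw [← Finset.mul_sum, hDl]
        exact mul_le_mul_of_nonneg_left (sum_rpow_pow_le hl h.lt_one hθ0 hθ1 L) (by positivity)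
    _ ≤ _ := by
        rw [growth_succ]
        have h5 : 4 / min s (1 - s) ≤ 4 * q ^ 2 / ((k + 1) * (q - (k + 1))) := by
          have h6 : 0 < (q : ℝ) - (k + 1) := by linarith
          have h7 : s * (1 - s) ≤ min s (1 - s) := by
            rcases le_total s (1 - s) with h | h
            · rw [min_eq_left h]; nlinarith
            · rw [min_eq_right h]; nlinarith
          have h8 : 4 * (q : ℝ) ^ 2 / ((k + 1) * (q - (k + 1))) = 4 / (s * (1 - s)) := by
            rw [hs]
            push_cast
            field_simp
          rw [h8]
          have : 0 < s * (1 - s) := mul_pos hs0 (by linarith)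
          gcongr
        calc _ = (D / ρ * (growth q ρ k * (ρ * (4 / min s (1 - s))))) * Real.exp (y * L) := by
              have : min s (1 - s) ≠ 0 := by
                intro h0
                rw [h0] at hθ0
                simp at hθ0
              field_simp
              ring
          _ ≤ _ := by gcongr

/-- Strong induction, since the remainder involves all lower orders. For the mean, the factor `3 ρ`
is absorbed by the factor `16 ρ` of `mul_growth_le`. -/
theorem momentBound (h : HasGap π A l) {q : ℕ} (hf : PowBall π (1 / q) 1 f)
    (hf0 : ∑ i, π i * f i = 0) {D ρ y : ℝ} (hDl : D = 1 / (1 - l)) (hD : 1 ≤ D) (hρ : D ≤ ρ)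
    (hy : y = D / ρ ^ 2) (k : ℕ) (hk : k < q) : MomentBound π A f q D ρ y k := by
  have hρ0 : 0 < ρ := by linarith
  have hy0 : 0 ≤ y := by rw [hy]; positivity
  induction k using Nat.strong_induction_on with
  | _ k ih =>
    rcases k with - | k
    · intro L
      rw [condMoment_zero h.row_sum]
      have h1 : 1 ≤ Real.exp (y * L) := Real.one_le_exp (by positivity)
      simp only [mul_one, h.law_sum, growth, Finset.range_zero, Finset.prod_empty, sub_self]
      exact ⟨by simpa using h1, PowBall.const h.law_sum.le _ (by simp; positivity)⟩
    · have hM : ∀ k' ≤ k, MomentBound π A f q D ρ y k' :=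
        fun k' hk' => ih k' (by omega) (by omega)
      refine fun L => ⟨(abs_mean_condMoment_le h hf hf0 hD hρ hy hk.le hM L).trans ?_,
        powBall_fluct_condMoment h hf hDl hD hρ hy0 hk hM L⟩
      have h1 := mul_growth_le (q := q) (hD.trans hρ) hk
      have h2 := growth_pos (q := q) (hD.trans hρ) (k := k) (by omega)
      have h3 : 0 < ρ * growth q ρ k := by positivity
      exact mul_le_mul_of_nonneg_right (by linarith) (Real.exp_pos _).le

/-- The denominators `i (q + 1 - i)` for `1 ≤ i ≤ q` multiply to `(q!)²`, and `(q + 1) ^ q / q! ≤ e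
^ (q + 1)`. Thus losses that are of order `q` near the two ends still multiply to an exponential
factor. -/
theorem growth_le {q : ℕ} {ρ : ℝ} (hρ : 0 ≤ ρ) :
    growth (q + 1) ρ q ≤ (4 * Real.exp 2) ^ (q + 1) * ρ ^ q := by
  have h1 : growth (q + 1) ρ q = ρ ^ q * (4 ^ q * (((q + 1 : ℕ) : ℝ) ^ q / q.factorial) ^ 2) := by
    have h2 : ∏ i ∈ Finset.range q, (((q + 1 : ℕ) : ℝ) - (i + 1)) = q.factorial := by
      rw [← Finset.prod_range_reflect, ← Finset.prod_range_add_one_eq_factorial]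
      push_cast
      refine Finset.prod_congr rfl fun i hi => ?_
      have h3 := Finset.mem_range.1 hi
      rw [Nat.cast_sub (by omega), Nat.cast_sub (by omega)]
      push_cast
      ring
    have h3 : ∏ i ∈ Finset.range q, ((i : ℝ) + 1) = q.factorial := by
      rw [← Finset.prod_range_add_one_eq_factorial]
      push_cast
      rfl
    rw [growth, Finset.prod_mul_distrib, Finset.prod_div_distrib, Finset.prod_mul_distrib,
      Finset.prod_mul_distrib, h2, h3]
    simp only [Finset.prod_const, Finset.card_range]
    rw [div_pow]
    ring
  have h4 : ((q + 1 : ℕ) : ℝ) ^ q / q.factorial ≤ Real.exp (q + 1 : ℕ) :=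
    Real.pow_div_factorial_le_exp _ (by positivity) q
  rw [h1, mul_comm]
  refine mul_le_mul_of_nonneg_right ?_ (by positivity)
  calc _ ≤ (4 : ℝ) ^ (q + 1) * Real.exp (q + 1 : ℕ) ^ 2 := by
        gcongr
        · norm_num
        · omega
    _ = (4 * Real.exp 2) ^ (q + 1) := by
        rw [mul_pow, ← Real.exp_nat_mul, ← Real.exp_nat_mul]
        congr 2
        push_cast
        ring

end MarkovConcentration

namespace MarkovConcentration

/-! ### Even moments of real functions of the chain -/

section Chain

variable {Ω : Type*} [MeasurableSpace Ω] {P : Measure Ω} {N : ℕ}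
  {W : ℕ → Ω → Fin N} {A : Matrix (Fin N) (Fin N) ℝ}

namespace IsMarkovChain

theorem measurable_comp (hW : IsMarkovChain P W A) (φ : Fin N → ℝ) (t : ℕ) :
    Measurable fun ω => φ (W t ω) :=
  (measurable_of_finite φ).comp (hW.measurable t)

theorem measurableSet_cylinder (hW : IsMarkovChain P W A) (t : ℕ) (x : ℕ → Fin N) :
    MeasurableSet {ω | ∀ s ≤ t, W s ω = x s} := by
  have : {ω | ∀ s ≤ t, W s ω = x s} = ⋂ s ∈ Set.Iic t, W s ⁻¹' {x s} := by
    ext ω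
    simp
  rw [this]
  exact MeasurableSet.biInter (Set.to_countable _) fun s _ =>
    hW.measurable s (measurableSet_singleton _)

theorem real_cylinder_update (hW : IsMarkovChain P W A) (t : ℕ) (x : ℕ → Fin N) (i : Fin N) :
    P.real {ω | ∀ s ≤ t + 1, W s ω = Function.update x (t + 1) i s} =
      P.real {ω | ∀ s ≤ t, W s ω = x s} * A (x t) i := by
  rw [hW.markov]
  congr 2
  · ext ω
    refine forall₂_congr fun s hs => ?_
    rw [Function.update_of_ne (by omega)]
  · rw [Function.update_of_ne (by omega)]
  · simp

theorem real_cylinder_zero (W : ℕ → Ω → Fin N) (i : Fin N) :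
    P.real {ω | ∀ s ≤ 0, W s ω = (fun _ => i : ℕ → Fin N) s} = initialLaw P W i := by
  simp [initialLaw]

theorem setIntegral_cylinder (hW : IsMarkovChain P W A) (t : ℕ) (x : ℕ → Fin N) {h : Ω → ℝ}
    (hh : Integrable h P) :
    ∫ ω in {ω | ∀ s ≤ t, W s ω = x s}, h ω ∂P =
      ∑ i, ∫ ω in {ω | ∀ s ≤ t + 1, W s ω = Function.update x (t + 1) i s}, h ω ∂P := by
  rw [← integral_iUnion_fintype (fun i => hW.measurableSet_cylinder _ _) ?_
    fun i => hh.integrableOn]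
  · congr 2
    ext ω
    simp only [Set.mem_ofPred_eq, Set.mem_iUnion]
    constructor
    · intro h
      refine ⟨W (t + 1) ω, fun s hs => ?_⟩
      rcases hs.eq_or_lt with rfl | hs
      · simp
      · rw [Function.update_of_ne (by omega)]
        exact h s (by omega)
    · rintro ⟨i, hi⟩ s hs
      rw [hi s (by omega), Function.update_of_ne (by omega)]
  · intro i j hij
    refine Set.disjoint_left.2 fun ω h1 h2 => hij ?_
    have h1' := h1 (t + 1) le_rfl
    have h2' := h2 (t + 1) le_rfl
    simp only [Function.update_self] at h1' h2'
    exact h1'.symm.trans h2'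

theorem integral_eq_sum (hW : IsMarkovChain P W A) {h : Ω → ℝ} (hh : Integrable h P) :
    ∫ ω, h ω ∂P = ∑ i, ∫ ω in {ω | ∀ s ≤ 0, W s ω = (fun _ => i : ℕ → Fin N) s}, h ω ∂P := by
  rw [← integral_iUnion_fintype (fun i => hW.measurableSet_cylinder _ _) ?_
    fun i => hh.integrableOn]
  · rw [← setIntegral_univ]
    congr 2
    ext ω
    simp
  · intro i j hij
    refine Set.disjoint_left.2 fun ω h1 h2 => hij ?_
    exact (h1 0 le_rfl).symm.trans (h2 0 le_rfl)

variable [IsProbabilityMeasure P]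

theorem integrable_comp (hW : IsMarkovChain P W A) (φ : Fin N → ℝ) (t : ℕ) :
    Integrable (fun ω => φ (W t ω)) P := by
  refine Integrable.of_bound (hW.measurable_comp φ t).aestronglyMeasurable (∑ i, |φ i|)
    (Filter.Eventually.of_forall fun ω => ?_)
  exact Finset.single_le_sum (f := fun i => |φ i|) (fun i _ => abs_nonneg _) (Finset.mem_univ _)

theorem integrable_sum_pow (hW : IsMarkovChain P W A) (f : Fin N → ℝ) (t L k : ℕ) :
    Integrable (fun ω => (∑ s ∈ Finset.range L, f (W (t + s) ω)) ^ k) P := by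
  refine Integrable.of_bound ((Finset.measurable_sum _ fun s _ =>
    hW.measurable_comp f (t + s)).pow_const k).aestronglyMeasurable ((L * ∑ i, |f i|) ^ k)
    (Filter.Eventually.of_forall fun ω => ?_)
  rw [norm_pow]
  refine pow_le_pow_left₀ (norm_nonneg _) ?_ k
  calc _ ≤ ∑ s ∈ Finset.range L, |f (W (t + s) ω)| := Finset.abs_sum_le_sum_abs _ _
    _ ≤ ∑ s ∈ Finset.range L, ∑ i, |f i| := Finset.sum_le_sum fun s _ =>
        Finset.single_le_sum (f := fun i => |f i|) (fun i _ => abs_nonneg _) (Finset.mem_univ _)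
    _ = _ := by simp

/-- Induction on the length: the binomial theorem separates the present state, which is fixed on the
cylinder, and the cylinder is then refined by the next state. Division by `k!` turns the binomial
expansion into the recursion of `condMoment`. -/
theorem setIntegral_sum_pow (hW : IsMarkovChain P W A) (f : Fin N → ℝ) (L : ℕ) :
    ∀ (t : ℕ) (x : ℕ → Fin N) (k : ℕ), ∫ ω in {ω | ∀ s ≤ t, W s ω = x s},
      (∑ s ∈ Finset.range L, f (W (t + s) ω)) ^ k / k.factorial ∂P =
      P.real {ω | ∀ s ≤ t, W s ω = x s} * condMoment A f L k (x t) := by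
  induction L with
  | zero =>
    intro t x k
    rcases k with - | k <;> simp [condMoment]
  | succ L ih =>
    intro t x k
    have h1 : ∀ ω ∈ {ω | ∀ s ≤ t, W s ω = x s},
        (∑ s ∈ Finset.range (L + 1), f (W (t + s) ω)) ^ k / k.factorial =
        ∑ j ∈ Finset.range (k + 1), f (x t) ^ j / j.factorial *
          ((∑ s ∈ Finset.range L, f (W (t + 1 + s) ω)) ^ (k - j) / (k - j).factorial) := by
      intro ω hω
      have h2 : ∑ s ∈ Finset.range L, f (W (t + (s + 1)) ω) =
          ∑ s ∈ Finset.range L, f (W (t + 1 + s) ω) :=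
        Finset.sum_congr rfl fun s _ => by rw [add_comm s 1, add_assoc]
      rw [Finset.sum_range_succ', add_comm, h2, add_zero, hω t le_rfl, add_pow, Finset.sum_div]
      refine Finset.sum_congr rfl fun j hj => ?_
      rw [Nat.cast_choose ℝ (by have := Finset.mem_range.1 hj; omega)]
      field_simp
    have hint : ∀ j, Integrable (fun ω => f (x t) ^ j / j.factorial *
          ((∑ s ∈ Finset.range L, f (W (t + 1 + s) ω)) ^ (k - j) / (k - j).factorial)) P :=
      fun j => ((hW.integrable_sum_pow f _ _ _).div_const _).const_mul _
    rw [setIntegral_congr_fun (hW.measurableSet_cylinder t x) h1,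
      integral_finsetSum _ fun j _ => (hint j).integrableOn]
    simp only [condMoment, Finset.mul_sum]
    refine Finset.sum_congr rfl fun j _ => ?_
    rw [integral_const_mul, hW.setIntegral_cylinder t x ((hW.integrable_sum_pow f _ _ _).div_const _)]
    simp only [ih, hW.real_cylinder_update, Function.update_self, Matrix.mulVec, dotProduct,
      Finset.mul_sum]
    exact Finset.sum_congr rfl fun i _ => by ring

theorem setIntegral_comp (hW : IsMarkovChain P W A) (φ : Fin N → ℝ) (L : ℕ) :
    ∀ (t : ℕ) (x : ℕ → Fin N), ∫ ω in {ω | ∀ s ≤ t, W s ω = x s}, φ (W (t + L) ω) ∂P =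
      P.real {ω | ∀ s ≤ t, W s ω = x s} * ((A ^ L) *ᵥ φ) (x t) := by
  induction L with
  | zero =>
    intro t x
    rw [setIntegral_congr_fun (g := fun _ => φ (x t)) (hW.measurableSet_cylinder t x) fun ω hω => by
      simp only [add_zero, hω t le_rfl]]
    simp
  | succ L ih =>
    intro t x
    rw [hW.setIntegral_cylinder t x (hW.integrable_comp φ _)]
    simp only [show t + (L + 1) = t + 1 + L by ring, ih, hW.real_cylinder_update,
      Function.update_self]
    rw [pow_succ', ← Matrix.mulVec_mulVec]
    conv_rhs => rw [Matrix.mulVec, dotProduct, Finset.mul_sum]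
    exact Finset.sum_congr rfl fun i _ => by ring

theorem integral_sum_pow (hW : IsMarkovChain P W A) (f : Fin N → ℝ) (L k : ℕ) :
    ∫ ω, (∑ s ∈ Finset.range L, f (W s ω)) ^ k ∂P =
      k.factorial * ∑ i, initialLaw P W i * condMoment A f L k i := by
  have h1 := hW.setIntegral_sum_pow f L 0
  simp only [zero_add] at h1
  have h2 := hW.integrable_sum_pow f 0 L k
  simp only [zero_add] at h2
  have h3 := hW.integral_eq_sum (h2.div_const (k.factorial : ℝ))
  simp only [h1, real_cylinder_zero, integral_div] at h3
  rw [← h3]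
  field_simp

theorem integral_comp (hW : IsMarkovChain P W A) (hs : IsStationaryLaw (initialLaw P W) A)
    (φ : Fin N → ℝ) (t : ℕ) : ∫ ω, φ (W t ω) ∂P = ∑ i, initialLaw P W i * φ i := by
  have h1 := hW.setIntegral_comp φ t 0
  simp only [zero_add] at h1
  rw [hW.integral_eq_sum (hW.integrable_comp φ t)]
  simp only [h1, real_cylinder_zero]
  have hs' : ∀ t : ℕ, initialLaw P W ᵥ* (A ^ t) = initialLaw P W := fun t => by
    induction t with
    | zero => simp
    | succ t ih => rw [pow_succ, ← Matrix.vecMul_vecMul, ih, hs]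
  exact sum_mul_mulVec (fun j => congrFun (hs' t) j) φ

end IsMarkovChain

variable [IsProbabilityMeasure P]

theorem powBall_of_sum_pow_le {X : Type*} [Fintype X] {π : X → ℝ} {q : ℕ} (hq : q ≠ 0) {f : X → ℝ}
    (hf : ∑ i, π i * |f i| ^ q ≤ 1) : PowBall π (1 / q) 1 f := by
  refine ⟨fun i => |f i| ^ q, fun i => by positivity, hf, fun i => ?_⟩
  rw [one_mul, one_div, Real.pow_rpow_inv_natCast (abs_nonneg _) hq]

/-- With `q = 2 m`: `q! ≤ q ^ q` combines with `ρ ^ q` into `(q ρ) ^ q`, and `q ρ = √(2 q x) ≤ 2 √(q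
x)`. The other constants are `3`, `4 e²` and `e`, each raised to the power `q`. -/
theorem three_mul_growth_le {m : ℕ} (hm : m ≠ 0) {x ρ : ℝ} (hρ : 0 ≤ ρ) (hx : ρ ^ 2 = x / m) :
    ((2 * m).factorial : ℝ) * (3 * ρ * growth (2 * m) ρ (2 * m - 1) * Real.exp m) ≤
      (24 * Real.exp 3 * √((2 * m : ℕ) * x)) ^ (2 * m) := by
  have hm' : (0 : ℝ) < m := by positivity
  have hxm : x = ρ ^ 2 * m := by rw [hx]; field_simp
  have h1 : growth (2 * m) ρ (2 * m - 1) ≤ (4 * Real.exp 2) ^ (2 * m) * ρ ^ (2 * m - 1) := by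
    have h := growth_le (q := 2 * m - 1) hρ
    rwa [show 2 * m - 1 + 1 = 2 * m by omega] at h
  have h0 : 0 ≤ growth (2 * m) ρ (2 * m - 1) := Finset.prod_nonneg fun i hi => by
    have h8 : ((i + 1 : ℕ) : ℝ) ≤ (2 * m : ℕ) := by
      exact_mod_cast (by have := Finset.mem_range.1 hi; omega)
    rw [Nat.cast_add_one] at h8
    have h9 := sub_nonneg.2 h8
    positivity
  have h2 : ρ ^ (2 * m) = ρ * ρ ^ (2 * m - 1) := by
    rw [← pow_succ', show 2 * m - 1 + 1 = 2 * m by omega]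
  have h3 : ((2 * m).factorial : ℝ) ≤ ((2 * m : ℕ) : ℝ) ^ (2 * m) := by
    exact_mod_cast Nat.factorial_le_pow (2 * m)
  have h4 : (3 : ℝ) ≤ 3 ^ (2 * m) := by
    calc (3 : ℝ) = 3 ^ 1 := by norm_num
      _ ≤ 3 ^ (2 * m) := pow_le_pow_right₀ (by norm_num) (by omega)
  have h5 : Real.exp m ≤ Real.exp 1 ^ (2 * m) := by
    rw [← Real.exp_nat_mul, Real.exp_le_exp]
    push_cast
    linarith
  have h6 : ((2 * m : ℕ) : ℝ) * ρ ≤ 2 * √((2 * m : ℕ) * x) := by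
    have h7 : (((2 * m : ℕ) : ℝ) * ρ / 2) ^ 2 ≤ (2 * m : ℕ) * x := by
      rw [hxm]
      push_cast
      have : 0 ≤ (m : ℝ) ^ 2 * ρ ^ 2 := by positivity
      nlinarith
    have := Real.le_sqrt_of_sq_le h7
    linarith
  calc _ ≤ ((2 * m : ℕ) : ℝ) ^ (2 * m) * (3 ^ (2 * m) * ρ *
        ((4 * Real.exp 2) ^ (2 * m) * ρ ^ (2 * m - 1)) * Real.exp 1 ^ (2 * m)) := by gcongr
    _ = (12 * (Real.exp 2 * Real.exp 1) * (((2 * m : ℕ) : ℝ) * ρ)) ^ (2 * m) := by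
        rw [mul_pow _ (((2 * m : ℕ) : ℝ) * ρ), mul_pow _ ρ, h2, mul_pow 12, mul_pow (Real.exp 2),
          mul_pow 4, show (12 : ℝ) = 3 * 4 by norm_num, mul_pow 3]
        ring
    _ ≤ (12 * (Real.exp 2 * Real.exp 1) * (2 * √((2 * m : ℕ) * x))) ^ (2 * m) := by gcongr
    _ = _ := by
        rw [← Real.exp_add]
        norm_num
        ring

theorem IsMarkovChain.integral_sum_pow_le (hW : IsMarkovChain P W A) {l : ℝ}
    (h : HasGap (initialLaw P W) A l) {m : ℕ} (hm : m ≠ 0) {f : Fin N → ℝ}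
    (hf : ∑ i, initialLaw P W i * f i ^ (2 * m) ≤ 1) (hf0 : ∑ i, initialLaw P W i * f i = 0)
    {n : ℕ} (hn : m ≤ n * (1 - l)) :
    ∫ ω, (∑ s ∈ Finset.range n, f (W s ω)) ^ (2 * m) ∂P ≤
      (24 * Real.exp 3 * √((2 * m : ℕ) * (n / (1 - l)))) ^ (2 * m) := by
  have hm' : (0 : ℝ) < m := by positivity
  have hl : 0 < 1 - l := by linarith [h.lt_one]
  have hl0 := h.pos
  have hn0 : (0 : ℝ) < n := by
    by_contra h0
    have : (n : ℝ) * (1 - l) ≤ 0 := mul_nonpos_of_nonpos_of_nonneg (by linarith) hl.le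
    linarith
  set D : ℝ := 1 / (1 - l) with hD
  have hD1 : 1 ≤ D := by rw [hD, le_div_iff₀ hl]; linarith
  -- Chosen so that `y n = D n / ρ² = m`, which limits the exponential factor to `e ^ m`. The
  -- requirement `D ≤ ρ` is then equivalent to `m ≤ n (1 - l)`.
  set ρ : ℝ := √(n / (1 - l) / m) with hρ
  have hρ2 : ρ ^ 2 = n / (1 - l) / m := Real.sq_sqrt (by positivity)
  have hDρ : D ≤ ρ := by
    refine Real.le_sqrt_of_sq_le ?_
    rw [hD, div_pow, one_pow, div_div, div_le_div_iff₀ (by positivity) (by positivity)]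
    nlinarith
  have hball : PowBall (initialLaw P W) (1 / (2 * m : ℕ)) 1 f :=
    powBall_of_sum_pow_le (by omega) (by simpa only [(even_two_mul m).pow_abs] using hf)
  have h1 := abs_mean_condMoment_le (L := n) h hball hf0 hD1 hDρ rfl
    (k := 2 * m - 1) (by omega)
    fun k' hk' => momentBound h hball hf0 hD hD1 hDρ rfl k' (by omega)
  rw [show 2 * m - 1 + 1 = 2 * m by omega, show D / ρ ^ 2 * n = m by rw [hρ2, hD]; field_simp] at h1
  rw [hW.integral_sum_pow]
  exact (mul_le_mul_of_nonneg_left ((le_abs_self _).trans h1) (by positivity)).trans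
    (three_mul_growth_le hm (by positivity) hρ2)

/-- Convexity of the even power and stationarity; no gap is needed. It serves the regime `m > n (1 -
l)`, where the claimed bound is at least 1. -/
theorem IsMarkovChain.integral_average_pow_le_one (hW : IsMarkovChain P W A)
    (hs : IsStationaryLaw (initialLaw P W) A) {m : ℕ} {f : Fin N → ℝ}
    (hf : ∑ i, initialLaw P W i * f i ^ (2 * m) ≤ 1) {n : ℕ} (hn : n ≠ 0) :
    ∫ ω, ((n : ℝ)⁻¹ * ∑ s ∈ Finset.range n, f (W s ω)) ^ (2 * m) ∂P ≤ 1 := by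
  have hint : ∀ s, Integrable (fun ω => (n : ℝ)⁻¹ * f (W s ω) ^ (2 * m)) P := fun s =>
    (hW.integrable_comp (fun i => f i ^ (2 * m)) s).const_mul _
  have hi := (hW.integrable_sum_pow f 0 n (2 * m)).const_mul ((n : ℝ)⁻¹ ^ (2 * m))
  simp only [zero_add, ← mul_pow] at hi
  calc _ ≤ ∫ ω, ∑ s ∈ Finset.range n, (n : ℝ)⁻¹ * f (W s ω) ^ (2 * m) ∂P := by
        refine integral_mono hi (integrable_finsetSum _ fun s _ => hint s) fun ω => ?_
        have h1 := Real.pow_arith_mean_le_arith_mean_pow_of_even (Finset.range n)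
          (fun _ => (n : ℝ)⁻¹) (fun s => f (W s ω)) (fun _ _ => by positivity)
          (by simp [hn]) (even_two_mul m)
        simpa only [Finset.mul_sum] using h1
    _ = ∑ s ∈ Finset.range n, (n : ℝ)⁻¹ * ∑ i, initialLaw P W i * f i ^ (2 * m) := by
        rw [integral_finsetSum _ fun s _ => hint s]
        refine Finset.sum_congr rfl fun s _ => ?_
        rw [integral_const_mul, hW.integral_comp hs (fun i => f i ^ (2 * m))]
    _ = ∑ i, initialLaw P W i * f i ^ (2 * m) := by simp [hn]
    _ ≤ 1 := hf

theorem IsMarkovChain.integral_average_pow_le_of_normalized (hW : IsMarkovChain P W A)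
    (hs : IsStationaryLaw (initialLaw P W) A) {l : ℝ}
    (h : HasGap (initialLaw P W) A l) {m : ℕ} (hm : m ≠ 0) {f : Fin N → ℝ}
    (hf : ∑ i, initialLaw P W i * f i ^ (2 * m) ≤ 1) (hf0 : ∑ i, initialLaw P W i * f i = 0)
    {n : ℕ} (hn : n ≠ 0) :
    ∫ ω, ((n : ℝ)⁻¹ * ∑ s ∈ Finset.range n, f (W s ω)) ^ (2 * m) ∂P ≤
      (24 * Real.exp 3 * √((2 * m : ℕ) / ((1 - l) * n))) ^ (2 * m) := by
  have hm' : (0 : ℝ) < m := by positivity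
  have hn' : (0 : ℝ) < n := by positivity
  have hl : 0 < 1 - l := by linarith [h.lt_one]
  rcases le_or_gt (m : ℝ) (n * (1 - l)) with hmn | hmn
  · simp only [mul_pow (n : ℝ)⁻¹, integral_const_mul]
    calc _ ≤ (n : ℝ)⁻¹ ^ (2 * m) *
          (24 * Real.exp 3 * √((2 * m : ℕ) * (n / (1 - l)))) ^ (2 * m) :=
          mul_le_mul_of_nonneg_left (hW.integral_sum_pow_le h hm hf hf0 hmn) (by positivity)
      _ = _ := by
          rw [← mul_pow]
          congr 1
          rw [show (((2 * m : ℕ) : ℝ) * (n / (1 - l))) = n ^ 2 * ((2 * m : ℕ) / ((1 - l) * n)) by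
            field_simp, Real.sqrt_mul (by positivity), Real.sqrt_sq hn'.le]
          field_simp
  · refine (hW.integral_average_pow_le_one hs hf hn).trans (one_le_pow₀ ?_)
    have h1 : 1 ≤ √(((2 * m : ℕ) : ℝ) / ((1 - l) * n)) := by
      rw [Real.one_le_sqrt, one_le_div (by positivity)]
      push_cast
      linarith
    have h2 := Real.one_le_exp (x := 3) (by norm_num)
    nlinarith

/-- Convexity, used for the power of a sum and for the power of the mean. Centring costs a factor
`2` in norm, which turns the constant `24` into `48`. -/
theorem sum_centered_pow_le {X : Type*} [Fintype X] {π : X → ℝ} (hπ : ∀ i, 0 ≤ π i)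
    (hπ1 : ∑ i, π i = 1) (f : X → ℝ) {m : ℕ} (hm : m ≠ 0) :
    ∑ i, π i * (f i - ∑ j, π j * f j) ^ (2 * m) ≤ 2 ^ (2 * m) * ∑ i, π i * f i ^ (2 * m) := by
  have h1 : (∑ j, π j * f j) ^ (2 * m) ≤ ∑ i, π i * f i ^ (2 * m) :=
    Real.pow_arith_mean_le_arith_mean_pow_of_even Finset.univ π f (fun i _ => hπ i) hπ1
      (even_two_mul m)
  calc _ ≤ ∑ i, (2 ^ (2 * m - 1) * (π i * f i ^ (2 * m)) +
        2 ^ (2 * m - 1) * (∑ j, π j * f j) ^ (2 * m) * π i) := by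
        refine Finset.sum_le_sum fun i _ => ?_
        have h2 := (even_two_mul m).add_pow_le (a := f i) (b := -∑ j, π j * f j)
        rw [(even_two_mul m).neg_pow, ← sub_eq_add_neg] at h2
        calc _ ≤ _ := mul_le_mul_of_nonneg_left h2 (hπ i)
          _ = _ := by ring
    _ = 2 ^ (2 * m - 1) * (∑ i, π i * f i ^ (2 * m) + (∑ j, π j * f j) ^ (2 * m)) := by
        rw [Finset.sum_add_distrib, ← Finset.mul_sum, ← Finset.mul_sum, hπ1]
        ring
    _ ≤ 2 ^ (2 * m - 1) * (∑ i, π i * f i ^ (2 * m) + ∑ i, π i * f i ^ (2 * m)) := by gcongr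
    _ = _ := by
        rw [show (2 : ℝ) ^ (2 * m) = 2 ^ (2 * m - 1) * 2 by
          rw [← pow_succ, show 2 * m - 1 + 1 = 2 * m by omega]]
        ring

/-- The moment inequality for real functions and even exponents. -/
theorem IsMarkovChain.integral_average_pow_le (hW : IsMarkovChain P W A)
    (hs : IsStationaryLaw (initialLaw P W) A) {l : ℝ}
    (h : HasGap (initialLaw P W) A l) {m : ℕ} (hm : m ≠ 0) (f : Fin N → ℝ)
    {n : ℕ} (hn : n ≠ 0) :
    ∫ ω, ((n : ℝ)⁻¹ * ∑ s ∈ Finset.range n, f (W s ω) - ∑ i, initialLaw P W i * f i) ^ (2 * m) ∂P ≤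
      (48 * Real.exp 3 * √((2 * m : ℕ) / ((1 - l) * n))) ^ (2 * m) *
        ∑ i, initialLaw P W i * f i ^ (2 * m) := by
  set π := initialLaw P W with hπ
  set M := ∑ i, π i * f i with hM
  set g : Fin N → ℝ := fun i => f i - M with hg
  have hl : 0 < 1 - l := by linarith [h.lt_one]
  have hn' : (0 : ℝ) < n := by positivity
  have hm' : (0 : ℝ) < m := by positivity
  have hg0 : ∑ i, π i * g i = 0 := by
    simp only [hg, mul_sub, Finset.sum_sub_distrib, ← Finset.sum_mul, h.law_sum]
    rw [← hM]
    ring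
  have h1 : ∀ ω, (n : ℝ)⁻¹ * ∑ s ∈ Finset.range n, f (W s ω) - M =
      (n : ℝ)⁻¹ * ∑ s ∈ Finset.range n, g (W s ω) := fun ω => by
    simp only [hg, Finset.sum_sub_distrib, Finset.sum_const, Finset.card_range, nsmul_eq_mul]
    field_simp
  simp only [h1]
  set K := (24 * Real.exp 3 * √(((2 * m : ℕ) : ℝ) / ((1 - l) * n))) ^ (2 * m) with hK
  have hK0 : 0 < K := by positivity
  set R := ∑ i, π i * g i ^ (2 * m) with hR
  have hR0 : 0 ≤ R := Finset.sum_nonneg fun i _ =>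
    mul_nonneg (h.law_nonneg i) ((even_two_mul m).pow_nonneg _)
  -- Rescaling by `R' > R` avoids division by zero when `R = 0`; afterwards `R'` is brought down to
  -- `R`.
  have key : ∀ R' > R, ∫ ω, ((n : ℝ)⁻¹ * ∑ s ∈ Finset.range n, g (W s ω)) ^ (2 * m) ∂P ≤
      K * R' := by
    intro R' hR'
    have hR'0 : 0 < R' := hR0.trans_lt hR'
    set t := R' ^ ((2 * m : ℕ) : ℝ)⁻¹ with ht
    have ht0 : 0 < t := by positivity
    have htR : t ^ (2 * m) = R' := Real.rpow_inv_natCast_pow hR'0.le (by omega)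
    have h2 := hW.integral_average_pow_le_of_normalized hs h hm (f := fun i => t⁻¹ * g i) (by
      have h4 : ∑ i, initialLaw P W i * (t⁻¹ * g i) ^ (2 * m) = R'⁻¹ * R := by
        rw [hR, Finset.mul_sum]
        exact Finset.sum_congr rfl fun i _ => by rw [mul_pow, inv_pow, htR, mul_left_comm]
      rw [h4, inv_mul_le_iff₀ hR'0, mul_one]
      exact hR'.le) (by
      have h4 : ∑ i, initialLaw P W i * (t⁻¹ * g i) = t⁻¹ * ∑ i, π i * g i := by
        rw [Finset.mul_sum]
        exact Finset.sum_congr rfl fun i _ => by rw [mul_left_comm]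
      rw [h4, hg0, mul_zero]) hn
    have h4 : ∀ ω, ((n : ℝ)⁻¹ * ∑ s ∈ Finset.range n, t⁻¹ * g (W s ω)) ^ (2 * m) =
        R'⁻¹ * ((n : ℝ)⁻¹ * ∑ s ∈ Finset.range n, g (W s ω)) ^ (2 * m) := fun ω => by
      rw [← Finset.mul_sum, mul_left_comm, mul_pow, inv_pow, htR]
    simp only [h4, integral_const_mul] at h2
    rw [inv_mul_le_iff₀ hR'0] at h2
    linarith
  have h3 : ∫ ω, ((n : ℝ)⁻¹ * ∑ s ∈ Finset.range n, g (W s ω)) ^ (2 * m) ∂P ≤ K * R := by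
    by_contra! hlt
    obtain ⟨R', h4, h5⟩ := exists_between ((lt_div_iff₀' hK0).2 hlt)
    rw [lt_div_iff₀' hK0] at h5
    linarith [key R' h4]
  refine h3.trans ?_
  calc K * R ≤ K * (2 ^ (2 * m) * ∑ i, π i * f i ^ (2 * m)) :=
        mul_le_mul_of_nonneg_left (sum_centered_pow_le h.law_nonneg h.law_sum f hm) hK0.le
    _ = _ := by
        rw [hK, ← mul_assoc, ← mul_pow]
        congr 2
        ring

end Chain

end MarkovConcentration

namespace MarkovConcentration

/-! ### Vector-valued extensions of bounded kernels -/

section Kernel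

variable {X Y Z : Type*} [Fintype X] [Fintype Y] [Fintype Z] {a : X → ℝ} {b : Y → ℝ} {w : Z → ℝ}

/-- The `q`-th power of the norm in `L_q(a; L_p(b))`. -/
noncomputable def mixedSum (a : X → ℝ) (b : Y → ℝ) (q p : ℝ) (f : X → Y → ℂ) : ℝ :=
  ∑ x, a x * (∑ y, b y * ‖f x y‖ ^ p) ^ (q / p)

/-- The witnesses are the `q`-th power of the inner norm and the normalised density on each fibre.
Strict positivity of `b` forces `f` to vanish on fibres of norm zero. -/
theorem MixedBall.of_mixedSum_le_one (hb : ∀ y, 0 < b y) {q p : ℝ} (hq : 0 < q) (hp : 0 < p)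
    {f : X → Y → ℂ} (hf : mixedSum a b q p f ≤ 1) : MixedBall a b (1 / q) (1 / p) f := by
  have hN : ∀ x, 0 ≤ ∑ y, b y * ‖f x y‖ ^ p := fun x =>
    Finset.sum_nonneg fun y _ => mul_nonneg (hb y).le (by positivity)
  refine ⟨fun x => (∑ y, b y * ‖f x y‖ ^ p) ^ (q / p),
    fun x y => ‖f x y‖ ^ p / ∑ y, b y * ‖f x y‖ ^ p, fun x => Real.rpow_nonneg (hN x) _,
    fun x y => div_nonneg (by positivity) (hN x), hf, fun x => ?_, fun x y => ?_⟩
  · calc _ = (∑ y, b y * ‖f x y‖ ^ p) / ∑ y, b y * ‖f x y‖ ^ p := by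
          rw [Finset.sum_div]
          exact Finset.sum_congr rfl fun y _ => by rw [mul_div_assoc]
      _ ≤ 1 := div_self_le_one _
  · rcases (hN x).eq_or_lt with h0 | h0
    · have h1 := (Finset.sum_eq_zero_iff_of_nonneg fun y _ =>
        mul_nonneg (hb y).le (by positivity : 0 ≤ ‖f x y‖ ^ p)).1 h0.symm y (Finset.mem_univ y)
      have h2 : ‖f x y‖ ^ p = 0 := (mul_eq_zero.1 h1).resolve_left (hb y).ne'
      rw [(Real.rpow_eq_zero (norm_nonneg _) hp.ne').1 h2]
      exact mul_nonneg (Real.rpow_nonneg (Real.rpow_nonneg (hN x) _) _)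
        (Real.rpow_nonneg (div_nonneg (by positivity) (hN x)) _)
    · rw [Real.div_rpow (by positivity) (hN x), ← Real.rpow_mul (hN x),
        ← Real.rpow_mul (norm_nonneg _), mul_one_div_cancel hp.ne', Real.rpow_one,
        show q / p * (1 / q) = 1 / p by field_simp]
      exact le_of_eq (by field_simp)

theorem MixedBall.mixedSum_le_one (ha : ∀ x, 0 ≤ a x) (hb : ∀ y, 0 ≤ b y) {q p : ℝ} (hq : 0 < q)
    (hp : 0 < p) {f : X → Y → ℂ} (hf : MixedBall a b (1 / q) (1 / p) f) :
    mixedSum a b q p f ≤ 1 := by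
  obtain ⟨u, v, hu, hv, hau, hbv, hle⟩ := hf
  refine le_trans (Finset.sum_le_sum fun x _ => mul_le_mul_of_nonneg_left ?_ (ha x)) hau
  have h1 : ∑ y, b y * ‖f x y‖ ^ p ≤ u x ^ (p / q) := by
    calc _ ≤ ∑ y, u x ^ (p / q) * (b y * v x y) := Finset.sum_le_sum fun y _ => by
          rw [mul_left_comm]
          refine mul_le_mul_of_nonneg_left ?_ (hb y)
          calc _ ≤ (u x ^ (1 / q) * v x y ^ (1 / p)) ^ p :=
                Real.rpow_le_rpow (norm_nonneg _) (hle x y) hp.le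
            _ = _ := by
                rw [Real.mul_rpow (Real.rpow_nonneg (hu x) _) (Real.rpow_nonneg (hv x y) _),
                  ← Real.rpow_mul (hu x), ← Real.rpow_mul (hv x y), one_div_mul_cancel hp.ne',
                  Real.rpow_one, one_div_mul_eq_div]
      _ = u x ^ (p / q) * ∑ y, b y * v x y := by rw [Finset.mul_sum]
      _ ≤ u x ^ (p / q) * 1 :=
          mul_le_mul_of_nonneg_left (hbv x) (Real.rpow_nonneg (hu x) _)
      _ = _ := mul_one _
  calc _ ≤ (u x ^ (p / q)) ^ (q / p) := Real.rpow_le_rpow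
        (Finset.sum_nonneg fun y _ => mul_nonneg (hb y) (by positivity)) h1 (by positivity)
    _ = u x := by
        rw [← Real.rpow_mul (hu x), show p / q * (q / p) = 1 by field_simp, Real.rpow_one]

theorem sum_mul_geom_mean_le (ha : ∀ x, 0 ≤ a x) {u u' : X → ℝ} (hu : ∀ x, 0 ≤ u x)
    (hu' : ∀ x, 0 ≤ u' x) (hau : ∑ x, a x * u x ≤ 1) (hau' : ∑ x, a x * u' x ≤ 1) {s : ℝ}
    (hs : 0 ≤ s) (hs1 : s ≤ 1) : ∑ x, a x * (u x ^ s * u' x ^ (1 - s)) ≤ 1 := by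
  calc _ ≤ ∑ x, (s * (a x * u x) + (1 - s) * (a x * u' x)) := Finset.sum_le_sum fun x _ => by
        have h := Real.geom_mean_le_arith_mean2_weighted hs (sub_nonneg.2 hs1) (hu x) (hu' x)
          (by ring)
        calc _ ≤ a x * (s * u x + (1 - s) * u' x) := mul_le_mul_of_nonneg_left h (ha x)
          _ = _ := by ring
    _ = s * ∑ x, a x * u x + (1 - s) * ∑ x, a x * u' x := by
        rw [Finset.sum_add_distrib, Finset.mul_sum, Finset.mul_sum]
    _ ≤ 1 := by nlinarith

theorem MixedBall.norm_pairing_le (ha : ∀ x, 0 ≤ a x) (hb : ∀ y, 0 ≤ b y) {s r : ℝ}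
    (hs : 0 ≤ s) (hs1 : s ≤ 1) (hr : 0 ≤ r) (hr1 : r ≤ 1) {f g : X → Y → ℂ}
    (hf : MixedBall a b s r f) (hg : MixedBall a b (1 - s) (1 - r) g) :
    ‖∑ x, ∑ y, ((a x * b y : ℝ) : ℂ) * (f x y * g x y)‖ ≤ 1 := by
  obtain ⟨u, v, hu, hv, hau, hbv, hle⟩ := hf
  obtain ⟨u', v', hu', hv', hau', hbv', hle'⟩ := hg
  calc _ ≤ ∑ x, ∑ y, ‖((a x * b y : ℝ) : ℂ) * (f x y * g x y)‖ :=
        (norm_sum_le _ _).trans (Finset.sum_le_sum fun x _ => norm_sum_le _ _)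
    _ ≤ ∑ x, ∑ y, a x * (u x ^ s * u' x ^ (1 - s)) * (b y * (v x y ^ r * v' x y ^ (1 - r))) :=
        Finset.sum_le_sum fun x _ => Finset.sum_le_sum fun y _ => by
          rw [norm_mul, norm_mul, Complex.norm_real, Real.norm_of_nonneg (mul_nonneg (ha x) (hb y))]
          calc _ ≤ a x * b y * ((u x ^ s * v x y ^ r) * (u' x ^ (1 - s) * v' x y ^ (1 - r))) :=
                mul_le_mul_of_nonneg_left (mul_le_mul (hle x y) (hle' x y) (norm_nonneg _)
                  ((norm_nonneg _).trans (hle x y))) (mul_nonneg (ha x) (hb y))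
            _ = _ := by ring
    _ ≤ ∑ x, a x * (u x ^ s * u' x ^ (1 - s)) := Finset.sum_le_sum fun x _ => by
        rw [← Finset.mul_sum]
        exact mul_le_of_le_one_right (mul_nonneg (ha x) (mul_nonneg (Real.rpow_nonneg (hu x) _)
          (Real.rpow_nonneg (hu' x) _)))
          (sum_mul_geom_mean_le hb (hv x) (hv' x) (hbv x) (hbv' x) hr hr1)
    _ ≤ 1 := sum_mul_geom_mean_le ha hu hu' hau hau' hs hs1

theorem conj_mul_normalized (z : ℂ) : z * (starRingEnd ℂ z / (‖z‖ : ℂ)) = (‖z‖ : ℂ) := by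
  by_cases hz : z = 0
  · simp [hz]
  · have : (‖z‖ : ℂ) ≠ 0 := by simpa using hz
    rw [← mul_div_assoc, Complex.mul_conj', pow_two, mul_div_assoc, div_self this, mul_one]

theorem mixedSum_nonneg (ha : ∀ x, 0 ≤ a x) (hb : ∀ y, 0 ≤ b y) (q p : ℝ) (f : X → Y → ℂ) :
    0 ≤ mixedSum a b q p f :=
  Finset.sum_nonneg fun x _ => mul_nonneg (ha x) (Real.rpow_nonneg
    (Finset.sum_nonneg fun y _ => mul_nonneg (hb y) (by positivity)) _)

/-- The extremal test function is the conjugate phase of `G` times `u ^ (1 - 1/q) * v ^ (1 - 1/p)`,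
with `u` and `v` the normalised profiles of `G`. Its pairing with `G` is `Q ^ (1/q)`. -/
theorem mixedSum_le_of_dual (ha : ∀ x, 0 ≤ a x) (hb : ∀ y, 0 < b y) {q p : ℝ} (hq : 1 ≤ q)
    (hp : 1 ≤ p) {M : ℝ} (hM : 0 ≤ M) {G : X → Y → ℂ}
    (h : ∀ g, MixedBall a b (1 - 1 / q) (1 - 1 / p) g →
      ‖∑ x, ∑ y, ((a x * b y : ℝ) : ℂ) * (G x y * g x y)‖ ≤ M) :
    mixedSum a b q p G ≤ M ^ q := by
  have hq0 : 0 < q := by linarith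
  have hp0 : 0 < p := by linarith
  set Q := mixedSum a b q p G with hQ
  rcases (mixedSum_nonneg ha (fun y => (hb y).le) q p G).eq_or_lt with h0 | hQ0
  · rw [hQ, ← h0]
    positivity
  rw [← hQ] at hQ0
  set n : X → ℝ := fun x => ∑ y, b y * ‖G x y‖ ^ p with hn
  have hn0 : ∀ x, 0 ≤ n x := fun x =>
    Finset.sum_nonneg fun y _ => mul_nonneg (hb y).le (by positivity)
  set u : X → ℝ := fun x => n x ^ (q / p) / Q with hu
  set v : X → Y → ℝ := fun x y => ‖G x y‖ ^ p / n x with hv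
  have hu0 : ∀ x, 0 ≤ u x := fun x => div_nonneg (Real.rpow_nonneg (hn0 x) _) hQ0.le
  have hv0 : ∀ x y, 0 ≤ v x y := fun x y => div_nonneg (by positivity) (hn0 x)
  have hau : ∑ x, a x * u x = 1 := by
    calc _ = Q / Q := by
          rw [hQ, mixedSum, Finset.sum_div]
          exact Finset.sum_congr rfl fun x _ => by rw [hu, mul_div_assoc]; rfl
      _ = 1 := div_self hQ0.ne'
  have hbv : ∀ x, ∑ y, b y * v x y = n x / n x := fun x => by
    rw [hn, Finset.sum_div]
    exact Finset.sum_congr rfl fun y _ => by rw [hv, mul_div_assoc]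
  have hGn : ∀ x y, n x = 0 → G x y = 0 := fun x y hx => by
    have h1 := (Finset.sum_eq_zero_iff_of_nonneg fun y _ =>
      mul_nonneg (hb y).le (by positivity : 0 ≤ ‖G x y‖ ^ p)).1 hx y (Finset.mem_univ y)
    have h2 : ‖G x y‖ ^ p = 0 := (mul_eq_zero.1 h1).resolve_left (hb y).ne'
    exact norm_eq_zero.1 ((Real.rpow_eq_zero (norm_nonneg _) hp0.ne').1 h2)
  have hG : ∀ x y, ‖G x y‖ * (u x ^ (1 - 1 / q) * v x y ^ (1 - 1 / p)) =
      Q ^ (1 / q) * (u x * v x y) := fun x y => by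
    by_cases hxy : G x y = 0
    · simp [hxy, hv, Real.zero_rpow hp0.ne']
    have hG0 : 0 < ‖G x y‖ := norm_pos_iff.2 hxy
    have hnx : 0 < n x := (hn0 x).lt_of_ne fun h => hxy (hGn x y h.symm)
    have hux : 0 < u x := by positivity
    have hvx : 0 < v x y := by positivity
    have h1 : ‖G x y‖ = Q ^ (1 / q) * (u x ^ (1 / q) * v x y ^ (1 / p)) := by
      rw [hu, hv]
      simp only
      rw [Real.div_rpow (by positivity) hQ0.le, Real.div_rpow (by positivity) hnx.le,
        ← Real.rpow_mul hnx.le, ← Real.rpow_mul hG0.le, mul_one_div_cancel hp0.ne', Real.rpow_one,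
        show q / p * (1 / q) = 1 / p by field_simp]
      field_simp
    have h2 : u x ^ (1 / q) * u x ^ (1 - 1 / q) = u x := by
      rw [← Real.rpow_add hux, add_sub_cancel, Real.rpow_one]
    have h3 : v x y ^ (1 / p) * v x y ^ (1 - 1 / p) = v x y := by
      rw [← Real.rpow_add hvx, add_sub_cancel, Real.rpow_one]
    rw [h1]
    calc _ = Q ^ (1 / q) * ((u x ^ (1 / q) * u x ^ (1 - 1 / q)) *
          (v x y ^ (1 / p) * v x y ^ (1 - 1 / p))) := by ring
      _ = _ := by rw [h2, h3]
  have h1 := h (fun x y => starRingEnd ℂ (G x y) / (‖G x y‖ : ℂ) *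
    ((u x ^ (1 - 1 / q) * v x y ^ (1 - 1 / p) : ℝ) : ℂ))
    ⟨u, v, hu0, hv0, hau.le, fun x => (hbv x).trans_le (div_self_le_one _), fun x y => by
      rw [norm_mul, norm_div, RCLike.norm_conj, Complex.norm_real, Complex.norm_real, norm_norm,
        Real.norm_of_nonneg (mul_nonneg (Real.rpow_nonneg (hu0 x) _) (Real.rpow_nonneg (hv0 x y) _))]
      exact mul_le_of_le_one_left (mul_nonneg (Real.rpow_nonneg (hu0 x) _)
        (Real.rpow_nonneg (hv0 x y) _)) (div_self_le_one _)⟩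
  have h2 : ∑ x, ∑ y, ((a x * b y : ℝ) : ℂ) * (G x y * (starRingEnd ℂ (G x y) / (‖G x y‖ : ℂ) *
      ((u x ^ (1 - 1 / q) * v x y ^ (1 - 1 / p) : ℝ) : ℂ))) = ((Q ^ (1 / q) : ℝ) : ℂ) := by
    have h3 : ∀ x y, ((a x * b y : ℝ) : ℂ) * (G x y * (starRingEnd ℂ (G x y) / (‖G x y‖ : ℂ) *
      ((u x ^ (1 - 1 / q) * v x y ^ (1 - 1 / p) : ℝ) : ℂ))) =
      ((Q ^ (1 / q) * ((a x * u x) * (b y * v x y)) : ℝ) : ℂ) := fun x y => by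
      rw [← mul_assoc (G x y), conj_mul_normalized, ← Complex.ofReal_mul, hG, ← Complex.ofReal_mul]
      congr 1
      ring
    simp only [h3]
    norm_cast
    simp only [← Finset.mul_sum, hbv]
    have h4 : ∀ x, a x * u x * (n x / n x) = a x * u x := fun x => by
      by_cases hx : n x = 0
      · have : q / p ≠ 0 := by positivity
        simp [hu, hx, Real.zero_rpow this]
      · rw [div_self hx, mul_one]
    simp only [h4, hau, mul_one]
  rw [h2, Complex.norm_real, Real.norm_of_nonneg (by positivity)] at h1
  calc Q = (Q ^ (1 / q)) ^ q := by
        rw [← Real.rpow_mul hQ0.le, one_div_mul_cancel hq0.ne', Real.rpow_one]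
    _ ≤ M ^ q := Real.rpow_le_rpow (by positivity) h1 hq0.le

/-- The kernel `K` acts from `L_q(a; L_p(b))` to `L_q(w; L_p(b))` with norm at most `M`. -/
def KernelBound (a : X → ℝ) (b : Y → ℝ) (w : Z → ℝ) (K : Z → X → ℝ) (M q p : ℝ) : Prop :=
  ∀ f : X → Y → ℂ, mixedSum w b q p (fun z y => ∑ x, (K z x : ℂ) * f x y) ≤
    M ^ q * mixedSum a b q p f

theorem mixedSum_const_mul (hb : ∀ y, 0 ≤ b y) {q p : ℝ} (hp : 0 < p) (k : ℂ) (f : X → Y → ℂ) :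
    mixedSum a b q p (fun x y => k * f x y) = ‖k‖ ^ q * mixedSum a b q p f := by
  rw [mixedSum, mixedSum, Finset.mul_sum]
  refine Finset.sum_congr rfl fun x _ => ?_
  have h1 : ∑ y, b y * ‖k * f x y‖ ^ p = ‖k‖ ^ p * ∑ y, b y * ‖f x y‖ ^ p := by
    rw [Finset.mul_sum]
    exact Finset.sum_congr rfl fun y _ => by
      rw [norm_mul, Real.mul_rpow (norm_nonneg _) (norm_nonneg _), mul_left_comm]
  rw [h1, Real.mul_rpow (by positivity)
    (Finset.sum_nonneg fun y _ => mul_nonneg (hb y) (by positivity)), ← Real.rpow_mul (norm_nonneg _),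
    mul_div_cancel₀ _ hp.ne', mul_left_comm]

theorem KernelBound.norm_pairing_le {K : Z → X → ℝ} {M q p : ℝ} (ha : ∀ x, 0 ≤ a x)
    (hw : ∀ z, 0 ≤ w z) (hb : ∀ y, 0 < b y) (hM : 0 < M) (hq : 1 ≤ q) (hp : 1 ≤ p)
    (hK : KernelBound a b w K M q p) {f : X → Y → ℂ} {g : Z → Y → ℂ}
    (hf : MixedBall a b (1 / q) (1 / p) f) (hg : MixedBall w b (1 - 1 / q) (1 - 1 / p) g) :
    ‖∑ z, ∑ y, ((w z * b y : ℝ) : ℂ) * ((∑ x, (K z x : ℂ) * f x y) * g z y)‖ ≤ M := by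
  have hq0 : 0 < q := by linarith
  have hp0 : 0 < p := by linarith
  have h1 := hf.mixedSum_le_one ha (fun y => (hb y).le) hq0 hp0
  have h2 : mixedSum w b q p (fun z y => ((M : ℂ)⁻¹) * ∑ x, (K z x : ℂ) * f x y) ≤ 1 := by
    rw [mixedSum_const_mul (fun y => (hb y).le) hp0, norm_inv, Complex.norm_real,
      Real.norm_of_nonneg hM.le, Real.inv_rpow hM.le, inv_mul_le_iff₀ (by positivity), mul_one]
    exact (hK f).trans (mul_le_of_le_one_right (by positivity) h1)
  have h3 := MixedBall.norm_pairing_le hw (fun y => (hb y).le) (by positivity)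
    (div_le_one_of_le₀ hq (by positivity)) (by positivity) (div_le_one_of_le₀ hp (by positivity))
    (MixedBall.of_mixedSum_le_one hb hq0 hp0 h2) hg
  have h4 : ∑ z, ∑ y, ((w z * b y : ℝ) : ℂ) * (((M : ℂ)⁻¹ * ∑ x, (K z x : ℂ) * f x y) * g z y) =
      (M : ℂ)⁻¹ * ∑ z, ∑ y, ((w z * b y : ℝ) : ℂ) * ((∑ x, (K z x : ℂ) * f x y) * g z y) := by
    simp only [Finset.mul_sum (a := (M : ℂ)⁻¹) (s := (Finset.univ : Finset Z)),
      Finset.mul_sum (a := (M : ℂ)⁻¹) (s := (Finset.univ : Finset Y))]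
    exact Finset.sum_congr rfl fun z _ => Finset.sum_congr rfl fun y _ => by ring
  rw [h4, norm_mul, norm_inv, Complex.norm_real, Real.norm_of_nonneg hM.le,
    inv_mul_le_iff₀ hM, mul_one] at h3
  exact h3

/-- Duality turns the kernel into a bilinear form, to which `MixedBall.riesz_thorin` applies; equal
constants at both ends give `M ^ (1 - θ) * M ^ θ = M`. -/
theorem KernelBound.interpolate {K : Z → X → ℝ} {M q₀ p₀ q₁ p₁ q p θ : ℝ} (ha : ∀ x, 0 ≤ a x)
    (hw : ∀ z, 0 ≤ w z) (hb : ∀ y, 0 < b y) (hM : 0 < M) (hq₀ : 1 ≤ q₀) (hp₀ : 1 ≤ p₀)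
    (hq₁ : 1 ≤ q₁) (hp₁ : 1 ≤ p₁) (hq : 1 ≤ q) (hp : 1 ≤ p) (hθ₀ : 0 ≤ θ) (hθ₁ : θ ≤ 1)
    (hqθ : 1 / q = (1 - θ) * (1 / q₀) + θ * (1 / q₁))
    (hpθ : 1 / p = (1 - θ) * (1 / p₀) + θ * (1 / p₁))
    (h₀ : KernelBound a b w K M q₀ p₀) (h₁ : KernelBound a b w K M q₁ p₁) :
    KernelBound a b w K M q p := by
  classical
  have hq0 : 0 < q := by linarith
  have hp0 : 0 < p := by linarith
  -- The form pairs only equal points of `Y`, whereas `riesz_thorin` has two independent inner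
  -- variables; the indicator of `t = y` reconciles them.
  have heq : ∀ (f : X → Y → ℂ) (g : Z → Y → ℂ), ∑ z, ∑ y, ((w z * b y : ℝ) : ℂ) *
      ((∑ x, (K z x : ℂ) * f x y) * g z y) =
      ∑ x, ∑ y, ∑ z, ∑ t, (if t = y then ((w z * b y * K z x : ℝ) : ℂ) else 0) *
        (f x y * g z t) := fun f g => by
    simp only [ite_mul, zero_mul, Finset.sum_ite_eq', Finset.mem_univ, if_true]
    simp only [Finset.sum_mul, Finset.mul_sum]
    conv_lhs => rw [Finset.sum_comm]
    conv_rhs => rw [Finset.sum_comm]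
    refine Finset.sum_congr rfl fun y _ => ?_
    rw [Finset.sum_comm]
    exact Finset.sum_congr rfl fun x _ => Finset.sum_congr rfl fun z _ => by push_cast; ring
  have hone : ∀ {r : ℝ}, 1 ≤ r → 0 ≤ 1 - 1 / r := fun hr =>
    sub_nonneg.2 (div_le_one_of_le₀ hr (by linarith))
  have key : ∀ f g, MixedBall a b (1 / q) (1 / p) f → MixedBall w b (1 - 1 / q) (1 - 1 / p) g →
      ‖∑ z, ∑ y, ((w z * b y : ℝ) : ℂ) * ((∑ x, (K z x : ℂ) * f x y) * g z y)‖ ≤ M := by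
    intro f g hf hg
    rw [heq]
    have h := MixedBall.riesz_thorin (a := a) (b := b) (w := w) (b' := b)
      (fun x y z t => if t = y then ((w z * b y * K z x : ℝ) : ℂ) else 0)
      (s₀ := 1 / q₀) (s₁ := 1 / q₁) (r₀ := 1 / p₀) (r₁ := 1 / p₁) (σ₀ := 1 - 1 / q₀)
      (σ₁ := 1 - 1 / q₁) (ρ₀ := 1 - 1 / p₀) (ρ₁ := 1 - 1 / p₁) (θ := θ) (M₀ := M) (M₁ := M)
      (by positivity) (by positivity) (by positivity) (by positivity) (hone hq₀) (hone hq₁)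
      (hone hp₀) (hone hp₁) hθ₀ hθ₁
      (fun f g hf hg => by
        rw [← heq]
        exact h₀.norm_pairing_le ha hw hb hM hq₀ hp₀ hf hg)
      (fun f g hf hg => by
        rw [← heq]
        exact h₁.norm_pairing_le ha hw hb hM hq₁ hp₁ hf hg) (f := f) (g := g)
      (by rwa [← hqθ, ← hpθ])
      (by
        convert hg using 1
        · rw [hqθ]; ring
        · rw [hpθ]; ring)
    rwa [← Real.rpow_add hM, sub_add_cancel, Real.rpow_one] at h
  have key2 : ∀ f : X → Y → ℂ, mixedSum a b q p f ≤ 1 →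
      mixedSum w b q p (fun z y => ∑ x, (K z x : ℂ) * f x y) ≤ M ^ q := fun f hf =>
    mixedSum_le_of_dual hw hb hq hp hM.le fun g hg =>
      key f g (MixedBall.of_mixedSum_le_one hb hq0 hp0 hf) hg
  intro f
  have hR0 := mixedSum_nonneg ha (fun y => (hb y).le) q p f
  have hMq : 0 < M ^ q := by positivity
  have key3 : ∀ R > mixedSum a b q p f,
      mixedSum w b q p (fun z y => ∑ x, (K z x : ℂ) * f x y) ≤ M ^ q * R := by
    intro R hR
    have hRpos : 0 < R := hR0.trans_lt hR
    have hnorm : ‖((R ^ (-(1 / q)) : ℝ) : ℂ)‖ ^ q = R⁻¹ := by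
      rw [Complex.norm_real, Real.norm_of_nonneg (by positivity), ← Real.rpow_mul hRpos.le,
        neg_mul, one_div_mul_cancel hq0.ne', Real.rpow_neg_one]
    have h := key2 (fun x y => ((R ^ (-(1 / q)) : ℝ) : ℂ) * f x y) (by
      rw [mixedSum_const_mul (fun y => (hb y).le) hp0, hnorm, inv_mul_le_iff₀ hRpos, mul_one]
      exact hR.le)
    simp only [mul_left_comm _ ((R ^ (-(1 / q)) : ℝ) : ℂ), ← Finset.mul_sum] at h
    rw [mixedSum_const_mul (fun y => (hb y).le) hp0, hnorm, inv_mul_le_iff₀ hRpos] at h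
    linarith
  by_contra! hlt
  obtain ⟨R', h4, h5⟩ := exists_between ((lt_div_iff₀' hMq).2 hlt)
  rw [lt_div_iff₀' hMq] at h5
  linarith [key3 R' h4]

end Kernel

end MarkovConcentration

namespace MarkovConcentration

/-! ### Euclidean-valued extension by averaging over directions -/

section Hilbert

open scoped RealInnerProductSpace

/-- The ball and its volume are invariant under the reflection taking a fixed unit vector to `v /
‖v‖`, so only the norm of `v` matters. The value of `κ` is irrelevant, as it cancels in the
application. -/
theorem exists_integral_inner_rpow {E : Type*} [NormedAddCommGroup E] [InnerProductSpace ℝ E]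
    [FiniteDimensional ℝ E] [MeasurableSpace E] [BorelSpace E] {q : ℝ} (hq : 0 < q) :
    ∃ κ : ℝ, 0 < κ ∧ ∀ v : E, ∫ y in Metric.closedBall (0 : E) 1, |⟪v, y⟫| ^ q = κ * ‖v‖ ^ q := by
  by_cases hE : ∃ e : E, ‖e‖ = 1
  swap
  · have h0 : ∀ v : E, v = 0 := fun v => by
      by_contra hv
      exact hE ⟨‖v‖⁻¹ • v, norm_smul_inv_norm (𝕜 := ℝ) hv⟩
    exact ⟨1, one_pos, fun v => by simp [h0 v, Real.zero_rpow hq.ne']⟩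
  obtain ⟨e, he⟩ := hE
  have hcont : ∀ v : E, Continuous fun y : E => |⟪v, y⟫| ^ q := fun v =>
    (by fun_prop : Continuous fun y : E => |⟪v, y⟫|).rpow_const fun _ => Or.inr hq.le
  refine ⟨∫ y in Metric.closedBall (0 : E) 1, |⟪e, y⟫| ^ q, ?_, fun v => ?_⟩
  · rw [setIntegral_pos_iff_support_of_nonneg_ae (Filter.Eventually.of_forall fun y => by positivity)
      ((hcont e).continuousOn.integrableOn_compact (isCompact_closedBall 0 1))]
    have ho : IsOpen (Metric.ball (0 : E) 1 ∩ {y | ⟪e, y⟫ ≠ 0}) :=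
      Metric.isOpen_ball.inter (isOpen_ne_fun (by fun_prop) continuous_const)
    refine (ho.measure_pos volume ⟨(1 / 2 : ℝ) • e, ?_, ?_⟩).trans_le (measure_mono ?_)
    · rw [mem_ball_zero_iff, norm_smul, he]
      norm_num
    · simp [inner_smul_right, he]
    · rintro y ⟨h1, h2⟩
      refine ⟨?_, Metric.ball_subset_closedBall h1⟩
      have : 0 < |⟪e, y⟫| := abs_pos.2 h2
      exact (by positivity : |⟪e, y⟫| ^ q ≠ 0)
  · by_cases hv : v = 0
    · simp [hv, Real.zero_rpow hq.ne']
    set v' : E := ‖v‖⁻¹ • v with hv'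
    have hn : ‖v'‖ = 1 := norm_smul_inv_norm (𝕜 := ℝ) hv
    have hvv : v = ‖v‖ • v' := by
      rw [hv', smul_smul, mul_inv_cancel₀ (norm_ne_zero_iff.2 hv), one_smul]
    set R : E ≃ₗᵢ[ℝ] E := (ℝ ∙ (e - v'))ᗮ.reflection with hR
    have hRe : R e = v' := Submodule.reflection_sub (he.trans hn.symm)
    have h1 := R.measurePreserving.setIntegral_preimage_emb
      R.toHomeomorph.measurableEmbedding (fun y => |⟪v', y⟫| ^ q) (Metric.closedBall 0 1)
    have h2 : R ⁻¹' Metric.closedBall 0 1 = Metric.closedBall 0 1 := by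
      ext y
      simp
    rw [h2] at h1
    have h3 : ∀ y, ⟪v', R y⟫ = ⟪e, y⟫ := fun y => by rw [← hRe, R.inner_map_map]
    simp only [h3] at h1
    rw [h1, mul_comm, ← integral_const_mul]
    congr 1
    funext y
    nth_rewrite 1 [hvv]
    rw [inner_smul_left, abs_mul, Real.mul_rpow (abs_nonneg _) (abs_nonneg _)]
    simp

/-- The Marcinkiewicz–Zygmund theorem: a kernel that is bounded on scalar functions is bounded with
the same constant on functions with values in a Euclidean space. -/
theorem sum_norm_rpow_le_of_scalar {X Z : Type*} [Fintype X] [Fintype Z] {a : X → ℝ} {w : Z → ℝ}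
    {K : Z → X → ℝ} {C q : ℝ} (hq : 0 < q)
    (hK : ∀ f : X → ℝ, ∑ z, w z * |∑ x, K z x * f x| ^ q ≤ C * ∑ x, a x * |f x| ^ q)
    {E : Type*} [NormedAddCommGroup E] [InnerProductSpace ℝ E] [FiniteDimensional ℝ E] (F : X → E) :
    ∑ z, w z * ‖∑ x, K z x • F x‖ ^ q ≤ C * ∑ x, a x * ‖F x‖ ^ q := by
  borelize E
  obtain ⟨κ, hκ, h⟩ := exists_integral_inner_rpow (E := E) hq
  have hint : ∀ v : E, IntegrableOn (fun y => |⟪v, y⟫| ^ q) (Metric.closedBall (0 : E) 1) := fun v =>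
    ((by fun_prop : Continuous fun y : E => |⟪v, y⟫|).rpow_const
      fun _ => Or.inr hq.le).continuousOn.integrableOn_compact (isCompact_closedBall 0 1)
  -- The scalar bound holds for the projections of `F` on every direction `y`; integration over `y`
  -- recovers the norms.
  have h1 : ∫ y in Metric.closedBall (0 : E) 1, ∑ z, w z * |⟪∑ x, K z x • F x, y⟫| ^ q ≤
      ∫ y in Metric.closedBall (0 : E) 1, C * ∑ x, a x * |⟪F x, y⟫| ^ q := by
    refine integral_mono (integrable_finsetSum _ fun z _ => (hint _).const_mul _)
      ((integrable_finsetSum _ fun x _ => (hint _).const_mul _).const_mul _) fun y => ?_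
    simpa only [sum_inner, inner_smul_left, RCLike.conj_to_real] using hK fun x => ⟪F x, y⟫
  rw [integral_finsetSum _ fun z _ => (hint _).const_mul _, integral_const_mul,
    integral_finsetSum _ fun x _ => (hint _).const_mul _] at h1
  simp only [integral_const_mul, h] at h1
  simp only [mul_left_comm _ κ, ← Finset.mul_sum] at h1
  exact le_of_mul_le_mul_left h1 hκ

end Hilbert

/-! ### From scalar bounds to mixed-norm bounds -/

section Extension

variable {X Y Z : Type*} [Fintype X] [Fintype Y] [Fintype Z] {a : X → ℝ} {b : Y → ℝ} {w : Z → ℝ}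
  {K : Z → X → ℝ}

/-- The kernel `K` acts from `L_q(a)` to `L_q(w)` with norm at most `M`, for real functions. -/
def ScalarBound (a : X → ℝ) (w : Z → ℝ) (K : Z → X → ℝ) (M q : ℝ) : Prop :=
  ∀ f : X → ℝ, ∑ z, w z * |∑ x, K z x * f x| ^ q ≤ M ^ q * ∑ x, a x * |f x| ^ q

theorem ScalarBound.complex {M q : ℝ} (hq : 0 < q) (h : ScalarBound a w K M q) (f : X → ℂ) :
    ∑ z, w z * ‖∑ x, (K z x : ℂ) * f x‖ ^ q ≤ M ^ q * ∑ x, a x * ‖f x‖ ^ q := by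
  simpa only [Complex.real_smul] using sum_norm_rpow_le_of_scalar hq h f

/-- When the inner and outer exponents agree, the sums can be interchanged and the scalar bound used
at each `y`. -/
theorem ScalarBound.kernelBound_diag {M q : ℝ} (hb : ∀ y, 0 ≤ b y) (hq : 0 < q)
    (h : ScalarBound a w K M q) : KernelBound a b w K M q q := by
  intro f
  simp only [mixedSum, div_self hq.ne', Real.rpow_one, Finset.mul_sum (s := (Finset.univ : Finset Y))]
  rw [Finset.sum_comm]
  conv_rhs => rw [Finset.sum_comm]
  rw [Finset.mul_sum]
  refine Finset.sum_le_sum fun y _ => ?_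
  have h1 := mul_le_mul_of_nonneg_left (h.complex hq fun x => f x y) (hb y)
  calc _ = b y * ∑ z, w z * ‖∑ x, (K z x : ℂ) * f x y‖ ^ q := by
        rw [Finset.mul_sum]
        exact Finset.sum_congr rfl fun z _ => by ring
    _ ≤ _ := h1
    _ = _ := by
        rw [mul_left_comm]
        congr 1
        rw [Finset.mul_sum]
        exact Finset.sum_congr rfl fun z _ => by ring

/-- Weighted `ℓ_2` over `ℂ` is a real Euclidean space: `T` absorbs the weight through `√b` and
separates real and imaginary parts. -/
theorem ScalarBound.kernelBound_two {M q : ℝ} (hb : ∀ y, 0 ≤ b y) (hq : 0 < q)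
    (h : ScalarBound a w K M q) : KernelBound a b w K M q 2 := by
  intro f
  set T : (Y → ℂ) → EuclideanSpace ℝ (Y × Fin 2) := fun g =>
    WithLp.toLp 2 fun i => √(b i.1) * ![(g i.1).re, (g i.1).im] i.2 with hT
  have hnorm : ∀ g : Y → ℂ, ‖T g‖ ^ q = (∑ y, b y * ‖g y‖ ^ (2 : ℝ)) ^ (q / 2) := fun g => by
    have h1 : ‖T g‖ ^ 2 = ∑ y, b y * ‖g y‖ ^ (2 : ℝ) := by
      rw [EuclideanSpace.norm_sq_eq, Fintype.sum_prod_type]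
      refine Finset.sum_congr rfl fun y _ => ?_
      simp only [hT, Fin.sum_univ_two, Real.norm_eq_abs, sq_abs, mul_pow, Real.sq_sqrt (hb y),
        Matrix.cons_val_zero, Matrix.cons_val_one]
      rw [Real.rpow_two, Complex.sq_norm, Complex.normSq_apply]
      ring
    rw [← h1, ← Real.rpow_natCast, ← Real.rpow_mul (norm_nonneg _)]
    congr 1
    push_cast
    ring
  have hlin : ∀ z, ∑ x, K z x • T (f x) = T fun y => ∑ x, (K z x : ℂ) * f x y := fun z => by
    ext ⟨y, i⟩
    fin_cases i <;>
    simp [hT, Finset.mul_sum, mul_left_comm]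
  have h1 := sum_norm_rpow_le_of_scalar hq h fun x => T (f x)
  simp only [hlin, hnorm] at h1
  exact h1

theorem ScalarBound.of_kernelBound {M q : ℝ} (hq : 0 < q)
    (h : KernelBound a (fun _ : Unit => 1) w K M q q) : ScalarBound a w K M q := by
  intro f
  have h1 := h fun x _ => (f x : ℂ)
  simp only [mixedSum, div_self hq.ne', Real.rpow_one, Finset.univ_unique, Finset.sum_singleton,
    one_mul, Complex.norm_real, ← Complex.ofReal_mul, ← Complex.ofReal_sum] at h1
  exact h1

theorem ScalarBound.interpolate {M q₀ q₁ q : ℝ} (ha : ∀ x, 0 ≤ a x)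
    (hw : ∀ z, 0 ≤ w z) (hM : 0 < M) (hq₀ : 1 ≤ q₀) (hq : q₀ ≤ q) (hq₁ : q ≤ q₁) (hlt : q₀ < q₁)
    (h₀ : ScalarBound a w K M q₀) (h₁ : ScalarBound a w K M q₁) : ScalarBound a w K M q := by
  have h0 : 0 < q₀ := by linarith
  have h1 : 0 < q := by linarith
  have h2 : 0 < q₁ := by linarith
  have h3 : 0 < q₁ - q₀ := by linarith
  refine ScalarBound.of_kernelBound h1 ?_
  have hθ : 1 / q = (1 - (1 / q₀ - 1 / q) / (1 / q₀ - 1 / q₁)) * (1 / q₀) +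
      (1 / q₀ - 1 / q) / (1 / q₀ - 1 / q₁) * (1 / q₁) := by
    have : 1 / q₀ - 1 / q₁ ≠ 0 := by
      rw [div_sub_div _ _ h0.ne' h2.ne', one_mul, mul_one]
      positivity
    field_simp
    ring
  have h4 : 1 / q₁ < 1 / q₀ := one_div_lt_one_div_of_lt h0 hlt
  have h5 : 1 / q ≤ 1 / q₀ := one_div_le_one_div_of_le h0 hq
  have h6 : 1 / q₁ ≤ 1 / q := one_div_le_one_div_of_le h1 hq₁
  exact KernelBound.interpolate ha hw (fun _ => one_pos) hM hq₀ hq₀ (by linarith) (by linarith)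
    (by linarith) (by linarith) (div_nonneg (by linarith) (by linarith))
    (div_le_one_of_le₀ (by linarith) (by linarith)) hθ hθ
    (h₀.kernelBound_diag (fun _ => zero_le_one) h0) (h₁.kernelBound_diag (fun _ => zero_le_one) h2)

/-- The outer exponent `q` stays fixed while the inner one is interpolated between `2` and `q`. -/
theorem ScalarBound.kernelBound {M q p : ℝ} (ha : ∀ x, 0 ≤ a x)
    (hw : ∀ z, 0 ≤ w z) (hb : ∀ y, 0 < b y) (hM : 0 < M) (hp : 2 ≤ p) (hpq : p ≤ q)
    (h : ScalarBound a w K M q) : KernelBound a b w K M q p := by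
  have hq0 : 0 < q := by linarith
  have h2 := h.kernelBound_two (fun y => (hb y).le) hq0
  rcases hp.eq_or_lt with rfl | hp2
  · exact h2
  have h1 := h.kernelBound_diag (fun y => (hb y).le) hq0
  have h4 : 1 / q < 1 / 2 := one_div_lt_one_div_of_lt two_pos (by linarith)
  have h5 : 1 / p ≤ 1 / 2 := one_div_le_one_div_of_le two_pos hp
  have h6 : 1 / q ≤ 1 / p := one_div_le_one_div_of_le (by linarith) hpq
  have h7 : 1 / 2 - 1 / q ≠ 0 := by linarith
  refine KernelBound.interpolate (θ := (1 / 2 - 1 / p) / (1 / 2 - 1 / q)) ha hw hb hM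
    (by linarith) (by norm_num) (by linarith) (by linarith) (by linarith) (by linarith)
    (div_nonneg (by linarith) (by linarith)) (div_le_one_of_le₀ (by linarith) (by linarith))
    (by ring) ?_ h2 h1
  generalize 1 / q = s at *
  generalize 1 / p = r at *
  generalize (1 / 2 : ℝ) = t at *
  field_simp
  ring

end Extension

end MarkovConcentration

namespace MarkovConcentration

/-! ### Passage to `L_p(μ)` through simple functions -/

section SimpleFunctions

variable {S : Type*} [MeasurableSpace S] {μ : Measure S} {X : Type}

/-- On level sets of infinite measure `φ` must vanish, because `v` lies in `L_p`; the value `0` of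
`μ.real` there does no harm. -/
theorem norm_rpow_eq_sum_of_simpleFunc {p : ℝ} (hp : 0 < p) {h : SimpleFunc S (X → ℝ)}
    {φ : (X → ℝ) → ℝ} {v : Lp ℝ (ENNReal.ofReal p) μ} (hv : v =ᵐ[μ] fun s => φ (h s)) :
    ‖v‖ ^ p = ∑ y ∈ h.range, μ.real (h ⁻¹' {y}) * |φ y| ^ p := by
  have hp' : (ENNReal.ofReal p).toReal = p := ENNReal.toReal_ofReal hp.le
  have hp0 : ENNReal.ofReal p ≠ 0 := by simpa using hp
  have hint : ∫⁻ s, ‖v s‖ₑ ^ p ∂μ = ∑ y ∈ h.range, ‖φ y‖ₑ ^ p * μ (h ⁻¹' {y}) := by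
    rw [lintegral_congr_ae (g := (h.map fun y => ‖φ y‖ₑ ^ p)) (by
      filter_upwards [hv] with s hs
      rw [hs]
      rfl), SimpleFunc.lintegral_eq_lintegral, SimpleFunc.map_lintegral]
  have hfin : ∫⁻ s, ‖v s‖ₑ ^ p ∂μ ≠ ⊤ := by
    have := lintegral_rpow_enorm_lt_top_of_eLpNorm_lt_top hp0 ENNReal.ofReal_ne_top (Lp.eLpNorm_lt_top v)
    rw [hp'] at this
    exact this.ne
  have hnorm : ‖v‖ ^ p = (∫⁻ s, ‖v s‖ₑ ^ p ∂μ).toReal := by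
    rw [Lp.norm_def, eLpNorm_eq_lintegral_rpow_enorm_toReal hp0 ENNReal.ofReal_ne_top, hp',
      ← ENNReal.toReal_rpow, ← Real.rpow_mul ENNReal.toReal_nonneg, one_div_mul_cancel hp.ne',
      Real.rpow_one]
  rw [hnorm, hint, ENNReal.toReal_sum]
  · refine Finset.sum_congr rfl fun y _ => ?_
    rw [ENNReal.toReal_mul, ← ENNReal.toReal_rpow, toReal_enorm, Real.norm_eq_abs, mul_comm]
    rfl
  · intro y hy
    rw [hint] at hfin
    exact (ENNReal.sum_ne_top.1 hfin) y hy

variable [Fintype X]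

/-- Finitely many simple functions span an isometric copy of a finite weighted `ℓ_p` space. -/
theorem exists_finite_model {p : ℝ} (hp : 0 < p) (f : X → Lp ℝ (ENNReal.ofReal p) μ)
    (hf : ∀ x, f x ∈ Lp.simpleFunc ℝ (ENNReal.ofReal p) μ) :
    ∃ (Y : Type) (_ : Fintype Y) (b : Y → ℝ) (F : X → Y → ℝ), (∀ y, 0 < b y) ∧
      ∀ c : X → ℝ, ‖∑ x, c x • f x‖ ^ p = ∑ y, b y * |∑ x, c x * F x y| ^ p := by
  classical
  set g : X → SimpleFunc S ℝ := fun x => Lp.simpleFunc.toSimpleFunc ⟨f x, hf x⟩ with hg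
  have hfg : ∀ x, f x =ᵐ[μ] g x := fun x =>
    (Lp.simpleFunc.toSimpleFunc_eq_toFun ⟨f x, hf x⟩).symm
  -- All the functions are combined into one simple function, so a single partition serves every
  -- linear combination.
  let h : SimpleFunc S (X → ℝ) :=
    { toFun := fun s x => g x s
      measurableSet_fiber' := fun y =>
        (measurable_pi_lambda _ fun x => (g x).measurable) (measurableSet_singleton y)
      finite_range' := (Set.Finite.pi' fun x => (g x).finite_range).subset (by
        rintro _ ⟨s, rfl⟩ x
        exact ⟨s, rfl⟩) }
  -- Level sets of measure zero or infinity are discarded, to keep the weights strictly positive.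
  refine ⟨{y // y ∈ h.range.filter fun y => 0 < μ.real (h ⁻¹' {y})}, inferInstance,
    fun y => μ.real (h ⁻¹' {y.1}), fun x y => y.1 x, fun y => (Finset.mem_filter.1 y.2).2,
    fun c => ?_⟩
  have hv : (∑ x, c x • f x : Lp ℝ (ENNReal.ofReal p) μ) =ᵐ[μ]
      fun s => (fun y : X → ℝ => ∑ x, c x * y x) (h s) := by
    have h1 : ∀ᵐ s ∂μ, ∀ x, (c x • f x : Lp ℝ (ENNReal.ofReal p) μ) s = c x * g x s := by
      rw [ae_all_iff]
      intro x
      filter_upwards [Lp.coeFn_smul (c x) (f x), hfg x] with s h1 h2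
      rw [h1, Pi.smul_apply, h2, smul_eq_mul]
    filter_upwards [Lp.coeFn_finsetSum Finset.univ fun x => c x • f x, h1] with s h2 h3
    rw [h2, Finset.sum_apply]
    exact Finset.sum_congr rfl fun x _ => h3 x
  rw [norm_rpow_eq_sum_of_simpleFunc (h := h) (φ := fun y => ∑ x, c x * y x) hp hv]
  rw [Finset.sum_coe_sort (h.range.filter fun y => 0 < μ.real (h ⁻¹' {y}))
    fun y => μ.real (h ⁻¹' {y}) * |∑ x, c x * y x| ^ p, Finset.sum_filter]
  refine Finset.sum_congr rfl fun y _ => ?_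
  split_ifs with h0
  · rfl
  · rw [le_antisymm (not_lt.1 h0) measureReal_nonneg, zero_mul]

/-- A kernel that is bounded on scalar `L_q`, `q ≥ p ≥ 2`, is bounded on `L_q(L_p(μ))`. -/
theorem ScalarBound.lp {Z : Type*} [Fintype Z] {a : X → ℝ} {w : Z → ℝ}
    {K : Z → X → ℝ} {M q p : ℝ} (ha : ∀ x, 0 ≤ a x) (hw : ∀ z, 0 ≤ w z) (hM : 0 < M) (hp : 2 ≤ p)
    (hpq : p ≤ q) [Fact (1 ≤ ENNReal.ofReal p)] (h : ScalarBound a w K M q)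
    (f : X → Lp ℝ (ENNReal.ofReal p) μ) :
    ∑ z, w z * ‖∑ x, K z x • f x‖ ^ q ≤ M ^ q * ∑ x, a x * ‖f x‖ ^ q := by
  classical
  have hp0 : 0 < p := by linarith
  have hq0 : 0 < q := by linarith
  have hdense : Dense (Set.univ.pi fun _ : X =>
      (Lp.simpleFunc ℝ (ENNReal.ofReal p) μ : Set (Lp ℝ (ENNReal.ofReal p) μ))) :=
    dense_pi _ fun _ _ => Lp.simpleFunc.dense ENNReal.ofReal_ne_top
  have hclosed : IsClosed {f : X → Lp ℝ (ENNReal.ofReal p) μ |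
      ∑ z, w z * ‖∑ x, K z x • f x‖ ^ q ≤ M ^ q * ∑ x, a x * ‖f x‖ ^ q} := by
    refine isClosed_le ?_ ?_
    · exact continuous_finsetSum _ fun z _ => continuous_const.mul
        (Continuous.rpow_const (by fun_prop) fun _ => Or.inr hq0.le)
    · exact continuous_const.mul (continuous_finsetSum _ fun x _ => continuous_const.mul
        (Continuous.rpow_const (by fun_prop) fun _ => Or.inr hq0.le))
  refine hdense.induction (P := fun f => ∑ z, w z * ‖∑ x, K z x • f x‖ ^ q ≤
    M ^ q * ∑ x, a x * ‖f x‖ ^ q) (fun f hf => ?_) hclosed f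
  obtain ⟨Y, _, b, F, hb, hF⟩ := exists_finite_model hp0 f fun x => hf x (Set.mem_univ x)
  have hpow : ∀ v : Lp ℝ (ENNReal.ofReal p) μ, (‖v‖ ^ p) ^ (q / p) = ‖v‖ ^ q := fun v => by
    rw [← Real.rpow_mul (norm_nonneg _), mul_div_cancel₀ _ hp0.ne']
  have h1 := h.kernelBound ha hw hb hM hp hpq fun x y => (F x y : ℂ)
  have h2 : ∀ x, ∑ y, b y * |F x y| ^ p = ‖f x‖ ^ p := fun x => by
    have h3 := hF (Pi.single x 1)
    simp only [Pi.single_apply, ite_smul, one_smul, zero_smul, ite_mul, one_mul, zero_mul,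
      Finset.sum_ite_eq', Finset.mem_univ, if_true] at h3
    exact h3.symm
  simp only [mixedSum, ← Complex.ofReal_mul, ← Complex.ofReal_sum, Complex.norm_real,
    Real.norm_eq_abs, ← hF, h2, hpow] at h1
  exact h1

end SimpleFunctions

end MarkovConcentration

namespace MarkovConcentration

/-! ### Concentration of Markov chains -/

section Main

variable {Ω : Type*} [MeasurableSpace Ω] {P : Measure Ω} [IsProbabilityMeasure P] {N : ℕ}
  {W : ℕ → Ω → Fin N} {A : Matrix (Fin N) (Fin N) ℝ}

theorem lambdaNorm_nonneg (π : Fin N → ℝ) (A : Matrix (Fin N) (Fin N) ℝ) : 0 ≤ lambdaNorm π A :=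
  Real.sSup_nonneg (by rintro r ⟨u, -, rfl⟩; exact Real.sqrt_nonneg _)

/-- Normalising `v` makes it a competitor in the supremum. If `v` has norm zero this is impossible,
and Jensen with stationarity shows that `A *ᵥ v` has norm zero as well. -/
theorem hasGap_of_lambdaNorm {π : Fin N → ℝ} (hπ : π ∈ stdSimplex ℝ (Fin N))
    (hA : A ∈ Matrix.rowStochastic ℝ (Fin N)) (hs : IsStationaryLaw π A) {l : ℝ}
    (hl : lambdaNorm π A ≤ l) (hl0 : 0 < l) (hl1 : l < 1) : HasGap π A l := by
  have hA1 : ∀ i, ∑ j, A i j = 1 := fun i => by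
    have h := congrFun hA.2 i
    simpa [Matrix.mulVec, dotProduct] using h
  have hst : ∀ j, ∑ i, π i * A i j = π j := fun j => congrFun hs j
  refine ⟨hπ.1, hπ.2, hA.1, hA1, hst, hl0, hl1, fun v hv => ?_⟩
  set R := ∑ i, π i * v i ^ 2 with hR
  have hR0 : 0 ≤ R := Finset.sum_nonneg fun i _ => mul_nonneg (hπ.1 i) (sq_nonneg _)
  rcases hR0.eq_or_lt with h0 | hRpos
  · rw [← h0, mul_zero, h0, hR]
    rw [← sum_mul_mulVec hst fun i => v i ^ 2]
    refine Finset.sum_le_sum fun i _ => mul_le_mul_of_nonneg_left ?_ (hπ.1 i)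
    exact Real.pow_arith_mean_le_arith_mean_pow_of_even Finset.univ (A i) v
      (fun j _ => hA.1 i j) (hA1 i) even_two
  have hmem : √(∑ i, π i * (∑ j, A i j * (v j / √R) - ∑ k, π k * (v k / √R)) ^ 2) ≤
      lambdaNorm π A := by
    refine le_csSup (bddAbove_lambdaNorm π A hπ hA hs) ⟨fun j => v j / √R, ?_, rfl⟩
    simp only [div_pow, Real.sq_sqrt hR0, ← mul_div_assoc]
    rw [← Finset.sum_div, ← hR, div_self hRpos.ne']
  have h1 : ∑ i, π i * (∑ j, A i j * (v j / √R) - ∑ k, π k * (v k / √R)) ^ 2 =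
      (∑ i, π i * (A *ᵥ v) i ^ 2) / R := by
    simp only [← mul_div_assoc, ← Finset.sum_div, hv, zero_div, sub_zero, div_pow, Real.sq_sqrt hR0]
    rfl
  rw [h1] at hmem
  have h2 := (Real.sqrt_le_left hl0.le).1 (hmem.trans hl)
  rwa [div_le_iff₀ hRpos] at h2

theorem initialLaw_mem_stdSimplex (hW : Measurable (W 0)) :
    initialLaw P W ∈ stdSimplex ℝ (Fin N) := by
  refine ⟨fun i => measureReal_nonneg, ?_⟩
  have h := sum_measureReal_preimage_singleton (μ := P) (f := W 0) Finset.univ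
    fun i _ => hW (measurableSet_singleton i)
  simp only [Finset.coe_univ, Set.preimage_univ, probReal_univ] at h
  exact h

theorem integral_path (hW : ∀ t, Measurable (W t)) (n : ℕ) {E : Type*} [NormedAddCommGroup E]
    [NormedSpace ℝ E] [CompleteSpace E] (F : (Fin n → Fin N) → E) :
    ∫ ω, F (fun s => W s ω) ∂P = ∑ z, P.real {ω | (fun s : Fin n => W s ω) = z} • F z := by
  have hV : Measurable fun ω (s : Fin n) => W s ω := measurable_pi_lambda _ fun s => hW s
  rw [← integral_map (f := F) hV.aemeasurable StronglyMeasurable.of_discrete.aestronglyMeasurable,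
    integral_fintype .of_finite]
  refine Finset.sum_congr rfl fun z _ => ?_
  rw [map_measureReal_apply hV (measurableSet_singleton z)]
  rfl

theorem integral_initial (hW : Measurable (W 0)) {E : Type*} [NormedAddCommGroup E]
    [NormedSpace ℝ E] [CompleteSpace E] (F : Fin N → E) :
    ∫ ω, F (W 0 ω) ∂P = ∑ i, initialLaw P W i • F i := by
  rw [← integral_map (f := F) hW.aemeasurable StronglyMeasurable.of_discrete.aestronglyMeasurable,
    integral_fintype .of_finite]
  refine Finset.sum_congr rfl fun z _ => ?_
  rw [map_measureReal_apply hW (measurableSet_singleton z)]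
  rfl

/-- The kernel of the operator `f ↦ (f W₀ + ⋯ + f W_{n-1}) / n - 𝔼 (f W₀)`. -/
noncomputable def deviationKernel (π : Fin N → ℝ) (n : ℕ) (z : Fin n → Fin N) (x : Fin N) : ℝ :=
  (n : ℝ)⁻¹ * (∑ s, if z s = x then 1 else 0) - π x

theorem sum_deviationKernel_smul (π : Fin N → ℝ) (n : ℕ) (z : Fin n → Fin N) {E : Type*}
    [AddCommGroup E] [Module ℝ E] (f : Fin N → E) :
    ∑ x, deviationKernel π n z x • f x = (n : ℝ)⁻¹ • ∑ s, f (z s) - ∑ x, π x • f x := by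
  simp only [deviationKernel, sub_smul, Finset.sum_sub_distrib, mul_smul, ← Finset.smul_sum,
    Finset.sum_smul]
  rw [Finset.sum_comm]
  simp

theorem IsMarkovChain.scalarBound_even (hW : IsMarkovChain P W A)
    (hs : IsStationaryLaw (initialLaw P W) A) {l : ℝ} (h : HasGap (initialLaw P W) A l) {m : ℕ}
    (hm : m ≠ 0) {n : ℕ} (hn : n ≠ 0) {M : ℝ}
    (hM : 48 * Real.exp 3 * √((2 * m : ℕ) / ((1 - l) * n)) ≤ M) :
    ScalarBound (initialLaw P W) (fun z => P.real {ω | (fun s : Fin n => W s ω) = z})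
      (deviationKernel (initialLaw P W) n) M (2 * m : ℕ) := by
  intro f
  have h1 := hW.integral_average_pow_le hs h hm f hn
  have h2 := integral_path (P := P) hW.measurable n fun z =>
    ((n : ℝ)⁻¹ * ∑ s, f (z s) - ∑ i, initialLaw P W i * f i) ^ (2 * m)
  have h3 := fun z => sum_deviationKernel_smul (initialLaw P W) n z f
  simp only [smul_eq_mul] at h2 h3
  simp only [Finset.sum_range fun s => f (W s _)] at h1
  rw [h2] at h1
  simp only [h3, Real.rpow_natCast, (even_two_mul m).pow_abs]
  refine h1.trans (mul_le_mul_of_nonneg_right ?_ (Finset.sum_nonneg fun i _ =>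
    mul_nonneg (h.law_nonneg i) ((even_two_mul m).pow_nonneg _)))
  exact pow_le_pow_left₀ (by positivity) hM _

theorem IsMarkovChain.scalarBound (hW : IsMarkovChain P W A)
    (hs : IsStationaryLaw (initialLaw P W) A) (hlt : chainLambda P W A < 1) {n : ℕ} (hn : n ≠ 0)
    {q : ℝ} (hq : 2 ≤ q) :
    ScalarBound (initialLaw P W) (fun z => P.real {ω | (fun s : Fin n => W s ω) = z})
      (deviationKernel (initialLaw P W) n)
      (96 * Real.exp 3 * √(q / ((1 - chainLambda P W A) * n))) q := by
  have hn' : (0 : ℝ) < n := by positivity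
  -- `HasGap` requires `l > 0`, while the chain may have `λ = 0`; the maximum with `1 / 2` shrinks
  -- the gap by at most a factor `2`.
  set l := max (chainLambda P W A) (1 / 2) with hl
  have hl1 : l < 1 := max_lt hlt (by norm_num)
  have hl0 : 0 < l := lt_of_lt_of_le (by norm_num) (le_max_right _ _)
  have hπ := initialLaw_mem_stdSimplex (P := P) (hW.measurable 0)
  have hgap : HasGap (initialLaw P W) A l :=
    hasGap_of_lambdaNorm hπ hW.stochastic hs (le_max_left _ _) hl0 hl1
  have hlam : 0 ≤ chainLambda P W A := lambdaNorm_nonneg _ _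
  have hl2 : (1 - chainLambda P W A) / 2 ≤ 1 - l := by
    rcases max_cases (chainLambda P W A) (1 / 2) with ⟨h, -⟩ | ⟨h, -⟩ <;> rw [hl, h] <;> linarith
  have hD : 0 < 1 - chainLambda P W A := by linarith
  -- Rounding the exponent up to at most `2 q` and halving the gap together multiply the radicand by
  -- at most 4, whence `96 = 2 * 48`.
  have hbound : ∀ m : ℕ, ((2 * m : ℕ) : ℝ) ≤ 2 * q →
      48 * Real.exp 3 * √((2 * m : ℕ) / ((1 - l) * n)) ≤
        96 * Real.exp 3 * √(q / ((1 - chainLambda P W A) * n)) := fun m hm => by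
    have h1 : √(((2 * m : ℕ) : ℝ) / ((1 - l) * n)) ≤
        2 * √(q / ((1 - chainLambda P W A) * n)) := by
      refine Real.sqrt_le_iff.2 ⟨by positivity, ?_⟩
      rw [mul_pow, Real.sq_sqrt (by positivity)]
      calc _ ≤ 2 * q / ((1 - chainLambda P W A) / 2 * n) := by gcongr
        _ = _ := by field_simp
    calc _ ≤ 48 * Real.exp 3 * (2 * √(q / ((1 - chainLambda P W A) * n))) := by gcongr
      _ = _ := by ring
  -- The even integers `2 m ≤ q < 2 (m + 1)` enclose `q`, and `2 (m + 1) ≤ q + 2 ≤ 2 q`.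
  set m := ⌊q / 2⌋₊ with hm
  have hm1 : 1 ≤ m := Nat.le_floor (by push_cast; linarith)
  have hmq : (m : ℝ) ≤ q / 2 := Nat.floor_le (by linarith)
  have hqm : q / 2 < m + 1 := Nat.lt_floor_add_one _
  have hm1' : (1 : ℝ) ≤ m := by exact_mod_cast hm1
  refine ScalarBound.interpolate (q₀ := (2 * m : ℕ)) (q₁ := (2 * (m + 1) : ℕ)) hπ.1
    (fun z => measureReal_nonneg) (by positivity) ?_ ?_ ?_ ?_
    (hW.scalarBound_even hs hgap (by omega) hn (hbound m ?_))
    (hW.scalarBound_even hs hgap (by omega) hn (hbound (m + 1) ?_)) <;> push_cast <;> linarith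

theorem IsMarkovChain.integral_norm_rpow_le (hW : IsMarkovChain P W A)
    (hs : IsStationaryLaw (initialLaw P W) A) (hlt : chainLambda P W A < 1) {n : ℕ} (hn : n ≠ 0)
    {S : Type*} [MeasurableSpace S] {μ : Measure S} {p q : ℝ} (hp : 2 ≤ p) (hpq : p ≤ q)
    [Fact (1 ≤ ENNReal.ofReal p)] (f : Fin N → Lp ℝ (ENNReal.ofReal p) μ) :
    ∫ ω, ‖((n : ℝ)⁻¹ • (∑ t ∈ Finset.range n, f (W t ω))) - (∫ ω', f (W 0 ω') ∂P)‖ ^ q ∂P ≤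
      (96 * Real.exp 3 * √(q / ((1 - chainLambda P W A) * n))) ^ q *
        ∫ ω, ‖f (W 0 ω)‖ ^ q ∂P := by
  have hn' : (0 : ℝ) < n := by positivity
  have hD : 0 < 1 - chainLambda P W A := by linarith
  have hπ := initialLaw_mem_stdSimplex (P := P) (hW.measurable 0)
  have h := (hW.scalarBound hs hlt hn (hp.trans hpq)).lp hπ.1 (fun z => measureReal_nonneg)
    (by have : 0 < q := by linarith
        positivity) hp hpq f
  simp only [sum_deviationKernel_smul] at h
  have h1 := integral_path (P := P) hW.measurable n fun z =>
    ‖(n : ℝ)⁻¹ • ∑ s, f (z s) - ∑ x, initialLaw P W x • f x‖ ^ q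
  have h2 := integral_initial (P := P) (hW.measurable 0) fun x => ‖f x‖ ^ q
  simp only [smul_eq_mul] at h1 h2
  rw [← h1, ← h2] at h
  simp only [Finset.sum_range fun s => f (W s _)]
  rw [integral_initial (hW.measurable 0) f]
  exact h

theorem IsMarkovChain.measure_norm_ge_le (hW : IsMarkovChain P W A)
    (hs : IsStationaryLaw (initialLaw P W) A) (hlt : chainLambda P W A < 1) {n : ℕ} (hn : n ≠ 0)
    {S : Type*} [MeasurableSpace S] {μ : Measure S} {p : ℝ} (hp : 2 ≤ p)
    [Fact (1 ≤ ENNReal.ofReal p)] {f : Fin N → Lp ℝ (ENNReal.ofReal p) μ} (hf : f ≠ 0) {a : ℝ}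
    (ha : 0 < a) :
    P.real {ω | a * (⨆ j, ‖f j‖) ≤
      ‖((n : ℝ)⁻¹ • (∑ t ∈ Finset.range n, f (W t ω))) - (∫ ω', f (W 0 ω') ∂P)‖} ≤
      Real.exp (p - (2 * (96 * Real.exp 3) ^ 2 * Real.exp 1)⁻¹ *
        (1 - chainLambda P W A) * n * a ^ 2) := by
  have hn' : (0 : ℝ) < n := by positivity
  have hD : 0 < 1 - chainLambda P W A := by linarith
  set C : ℝ := 96 * Real.exp 3 with hC
  have hC0 : 0 < C := by positivity
  -- With this exponent the moment constant equals `a * exp (-1/2)`, so Markov's inequality yields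
  -- `exp (-q/2)`.
  set q : ℝ := (1 - chainLambda P W A) * n * a ^ 2 / (C ^ 2 * Real.exp 1) with hq
  have hexp : (2 * C ^ 2 * Real.exp 1)⁻¹ * (1 - chainLambda P W A) * n * a ^ 2 = q / 2 := by
    rw [hq]
    field_simp
  rw [hexp]
  -- For `q < p` the moment bound is unavailable, but then `p - q / 2 > 0` and the claim is trivial.
  rcases lt_or_ge q p with hqp | hpq
  · refine measureReal_le_one.trans (Real.one_le_exp ?_)
    linarith
  have hq0 : 0 < q := by linarith
  set B := ⨆ j, ‖f j‖ with hB
  have hle : ∀ j, ‖f j‖ ≤ B := fun j => le_ciSup (Set.finite_range fun j => ‖f j‖).bddAbove j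
  have hB0 : 0 < B := by
    obtain ⟨j, hj⟩ := Function.ne_iff.1 hf
    exact (norm_pos_iff.2 hj).trans_le (hle j)
  set F : Ω → ℝ := fun ω =>
    ‖((n : ℝ)⁻¹ • (∑ t ∈ Finset.range n, f (W t ω))) - (∫ ω', f (W 0 ω') ∂P)‖ with hF
  have h1 : ∫ ω, F ω ^ q ∂P ≤ (C * √(q / ((1 - chainLambda P W A) * n))) ^ q * B ^ q := by
    refine (hW.integral_norm_rpow_le hs hlt hn hp hpq f).trans
      (mul_le_mul_of_nonneg_left ?_ (by positivity))
    have h2 := integral_initial (P := P) (hW.measurable 0) fun x => ‖f x‖ ^ q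
    simp only [smul_eq_mul] at h2
    have hπ := initialLaw_mem_stdSimplex (P := P) (hW.measurable 0)
    rw [h2]
    calc _ ≤ ∑ i, initialLaw P W i * B ^ q := Finset.sum_le_sum fun i _ =>
          mul_le_mul_of_nonneg_left (Real.rpow_le_rpow (norm_nonneg _) (hle i) hq0.le) (hπ.1 i)
      _ = B ^ q := by rw [← Finset.sum_mul, hπ.2, one_mul]
  have hint : Integrable (fun ω => F ω ^ q) P := by
    set G : (Fin n → Fin N) → ℝ := fun z =>
      ‖(n : ℝ)⁻¹ • ∑ s, f (z s) - ∫ ω', f (W 0 ω') ∂P‖ ^ q with hG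
    have hV : Measurable fun ω (s : Fin n) => W s ω := measurable_pi_lambda _ fun s => hW.measurable s
    have h2 : Integrable (G ∘ fun ω (s : Fin n) => W s ω) P :=
      (Integrable.of_finite (μ := P.map fun ω (s : Fin n) => W s ω) (f := G)).comp_measurable hV
    refine h2.congr (Filter.Eventually.of_forall fun ω => ?_)
    simp only [hG, hF, Function.comp_apply, Finset.sum_range fun s => f (W s ω)]
  have h2 := mul_meas_ge_le_integral_of_nonneg (μ := P) (f := fun ω => F ω ^ q)
    (Filter.Eventually.of_forall fun ω => by positivity) hint ((a * B) ^ q)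
  have h3 : P.real {ω | a * B ≤ F ω} ≤ P.real {ω | (a * B) ^ q ≤ F ω ^ q} :=
    measureReal_mono fun ω hω => Real.rpow_le_rpow (by positivity) hω hq0.le
  have h4 : C * √(q / ((1 - chainLambda P W A) * n)) = a * Real.exp (-(1 / 2)) := by
    have h5 : q / ((1 - chainLambda P W A) * n) = (a * Real.exp (-(1 / 2)) / C) ^ 2 := by
      rw [div_pow, mul_pow, ← Real.exp_nat_mul, hq]
      have : Real.exp (((2 : ℕ) : ℝ) * -(1 / 2)) = (Real.exp 1)⁻¹ := by
        rw [← Real.exp_neg]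
        norm_num
      rw [this]
      field_simp
    rw [h5, Real.sqrt_sq (by positivity)]
    field_simp
  rw [h4, ← Real.mul_rpow (by positivity) hB0.le] at h1
  have h6 : (a * Real.exp (-(1 / 2)) * B) ^ q = (a * B) ^ q * Real.exp (-(q / 2)) := by
    rw [mul_right_comm, Real.mul_rpow (by positivity) (by positivity), ← Real.exp_mul]
    congr 2
    ring
  rw [h6] at h1
  have h7 : P.real {ω | (a * B) ^ q ≤ F ω ^ q} ≤ Real.exp (-(q / 2)) :=
    le_of_mul_le_mul_left (h2.trans h1) (by positivity)
  exact (h3.trans h7).trans (Real.exp_le_exp.2 (by linarith))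

end Main

end MarkovConcentration

theorem mainTheorem3 :
    ∃ C K c : ℝ, 0 < C ∧ 0 < K ∧ 0 < c ∧
      ∀ (p : ℝ) (_ : 2 ≤ p) [Fact (1 ≤ ENNReal.ofReal p)]
        {S : Type*} [MeasurableSpace S] (μ : Measure S)
        {Ω : Type*} [MeasurableSpace Ω] (P : Measure Ω) [IsProbabilityMeasure P]
        (N : ℕ) (W : ℕ → Ω → Fin N) (A : Matrix (Fin N) (Fin N) ℝ)
        (_ : MarkovConcentration.IsMarkovChain P W A)
        (_ : MarkovConcentration.IsStationaryLaw (MarkovConcentration.initialLaw P W) A)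
        (_ : MarkovConcentration.chainLambda P W A < 1)
        (f : Fin N → Lp ℝ (ENNReal.ofReal p) μ) (n : ℕ) (_ : 1 ≤ n),
        (∀ q : ℝ, p ≤ q →
          (∫ ω, ‖((n : ℝ)⁻¹ • (∑ t ∈ Finset.range n, f (W t ω))) - (∫ ω', f (W 0 ω') ∂P)‖ ^ q ∂P)
              ^ (1 / q) ≤
            C * √(q / ((1 - MarkovConcentration.chainLambda P W A) * n)) *
              (∫ ω, ‖f (W 0 ω)‖ ^ q ∂P) ^ (1 / q)) ∧
        (f ≠ 0 → ∀ a : ℝ, 0 < a →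
          P.real {ω | a * (⨆ j, ‖f j‖) ≤
              ‖((n : ℝ)⁻¹ • (∑ t ∈ Finset.range n, f (W t ω))) - (∫ ω', f (W 0 ω') ∂P)‖} ≤
            K * Real.exp (p - c * (1 - MarkovConcentration.chainLambda P W A) * n * a ^ 2)) := by
  refine ⟨96 * Real.exp 3, 1, (2 * (96 * Real.exp 3) ^ 2 * Real.exp 1)⁻¹, by positivity, one_pos,
    by positivity, ?_⟩
  intro p hp _ S _ μ Ω _ P _ N W A hW hs hlt f n hn
  have hn0 : n ≠ 0 := by omega
  refine ⟨fun q hpq => ?_, fun hf a ha => ?_⟩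
  · have hq0 : 0 < q := by linarith
    have hD : 0 < 1 - MarkovConcentration.chainLambda P W A := by linarith
    have h0 : 0 ≤ ∫ ω, ‖f (W 0 ω)‖ ^ q ∂P := integral_nonneg fun ω => by positivity
    have h := Real.rpow_le_rpow (integral_nonneg fun ω => by positivity)
      (hW.integral_norm_rpow_le hs hlt hn0 hp hpq f) (one_div_nonneg.2 hq0.le)
    rwa [Real.mul_rpow (by positivity) h0, ← Real.rpow_mul (by positivity),
      mul_one_div_cancel hq0.ne', Real.rpow_one] at h
  · rw [one_mul]
    exact hW.measure_norm_ge_le hs hlt hn0 hp hf ha
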